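/- Let $N\ge 5$ be an integer and let $B=\{x\in\mathbb{R}^N : |x|<1\}$ be the open unit ball. Then for every real-valued $u\in C_c^\infty(B)$ (smooth with compact support in $B$) all the integrals below are finite, and \[ \int_B|\Delta u|^2\,dx\;\ge\;\frac{(N-2)^2(N-4)^2}{16}\int_B\frac{u^2}{\left(|x|^2-\frac{9}{10}|x|^{\frac N2+1}\right)\left(|x|^2-|x|^{\frac N2}\right)}\,dx+\frac{(N-1)(N-4)^2}{4}\int_B\frac{u^2}{|x|^2\left(|x|^2-|x|^{\frac N2}\right)}\,dx . \] As a consequence, \[ \int_B|\Delta u|^2\,dx\;\ge\;\frac{N^2(N-4)^2}{16}\int_B\frac{u^2}{|x|^2\left(|x|^2-|x|^{\frac N2}\right)}\,dx . \] -/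

import Mathlib

open MeasureTheory
open scoped ContDiff

/-! Put E = x · ∇, m = (N - 2)/2, k = (N - 4)/2, q = (1 - γ|x|ᵐ)⁻¹ and p = (1 - |x|ᵏ)⁻¹. For γ =
9/10 the two weights are |x|⁻⁴ q p and |x|⁻⁴ p. The argument works for every γ in [0, 1], in two
stages away from the origin.

From Δu to ∇u (`rellich_gradient`): ∫ |Δu|² = ∫ |D²u|², and the block of D²u tangential to spheres
obeys the trace inequality in dimension N - 1 (`sq_trace_sub_le`). The mixed term of radial Hessian
and Laplacian is computed by parts (`integral_radialHessian_mul_laplacian`). A Hardy inequality for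
the tangential gradient (`two_mul_integral_tangential_le`) cancels the remaining radial terms and
leaves ∫ |Δu|² ≥ ∫ |x|⁻² Σ (E ∂ᵢu)² + (N - 1) ∫ |x|⁻² |∇u|². The improved Hardy inequality for each
∂ᵢu turns the first integral into ∫ m² q |x|⁻² |∇u|².

From ∇u to u (`improved_hardy_invSq_sq`): |∇u|² ≥ |x|⁻² (E u)², followed by a radial Hardy
inequality with weight (m² q + N - 1)|x|⁻⁴, which produces k² p.

Both improved Hardy inequalities come from `hardy_of_supersolution`, with the positive functions
|x|⁻ᵐ - γ and |x|⁻ᵏ - 1. The support condition at the origin is removed by cutoffs, since |x|⁻⁴ is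
integrable when N ≥ 5. -/

/-- The `i`-th partial derivative. -/
noncomputable def partialDeriv {N : ℕ} (i : Fin N) (f : EuclideanSpace ℝ (Fin N) → ℝ)
    (x : EuclideanSpace ℝ (Fin N)) : ℝ :=
  fderiv ℝ f x (EuclideanSpace.single i 1)

/-- The Euler operator `x · ∇`. -/
noncomputable def eulerDeriv {N : ℕ} (f : EuclideanSpace ℝ (Fin N) → ℝ)
    (x : EuclideanSpace ℝ (Fin N)) : ℝ :=
  fderiv ℝ f x x

/-- Smooth functions with compact support contained in `U`. -/
structure IsTestOn {N : ℕ} (U : Set (EuclideanSpace ℝ (Fin N)))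
    (f : EuclideanSpace ℝ (Fin N) → ℝ) : Prop where
  contDiff : ContDiff ℝ ∞ f
  compact : HasCompactSupport f
  subset : tsupport f ⊆ U

/-! ### Calculus of partial derivatives and of the Euler operator -/

section Rules

variable {N : ℕ} {f g : EuclideanSpace ℝ (Fin N) → ℝ} {x : EuclideanSpace ℝ (Fin N)}

lemma sum_coord_mul_partialDeriv (f : EuclideanSpace ℝ (Fin N) → ℝ)
    (x : EuclideanSpace ℝ (Fin N)) :
    ∑ i, x i * partialDeriv i f x = eulerDeriv f x := by
  have hx : x = ∑ i, x i • EuclideanSpace.single i (1 : ℝ) := by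
    ext j
    simp [Pi.single_apply]
  unfold partialDeriv eulerDeriv
  conv_rhs => rw [hx, map_sum]
  simp only [map_smul, smul_eq_mul]
  rw [← hx]

lemma partialDeriv_mul (i : Fin N) (hf : DifferentiableAt ℝ f x) (hg : DifferentiableAt ℝ g x) :
    partialDeriv i (fun y => f y * g y) x
      = f x * partialDeriv i g x + g x * partialDeriv i f x := by
  simp [partialDeriv, fderiv_fun_mul hf hg]

lemma partialDeriv_add (i : Fin N) (hf : DifferentiableAt ℝ f x) (hg : DifferentiableAt ℝ g x) :
    partialDeriv i (fun y => f y + g y) x = partialDeriv i f x + partialDeriv i g x := by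
  simp [partialDeriv, fderiv_fun_add hf hg]

lemma partialDeriv_sub (i : Fin N) (hf : DifferentiableAt ℝ f x) (hg : DifferentiableAt ℝ g x) :
    partialDeriv i (fun y => f y - g y) x = partialDeriv i f x - partialDeriv i g x := by
  simp [partialDeriv, fderiv_fun_sub hf hg]

lemma eulerDeriv_mul (hf : DifferentiableAt ℝ f x) (hg : DifferentiableAt ℝ g x) :
    eulerDeriv (fun y => f y * g y) x = f x * eulerDeriv g x + g x * eulerDeriv f x := by
  simp [eulerDeriv, fderiv_fun_mul hf hg]

lemma eulerDeriv_add (hf : DifferentiableAt ℝ f x) (hg : DifferentiableAt ℝ g x) :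
    eulerDeriv (fun y => f y + g y) x = eulerDeriv f x + eulerDeriv g x := by
  simp [eulerDeriv, fderiv_fun_add hf hg]

lemma eulerDeriv_sub (hf : DifferentiableAt ℝ f x) (hg : DifferentiableAt ℝ g x) :
    eulerDeriv (fun y => f y - g y) x = eulerDeriv f x - eulerDeriv g x := by
  simp [eulerDeriv, fderiv_fun_sub hf hg]

lemma hasFDerivAt_coord (i : Fin N) (x : EuclideanSpace ℝ (Fin N)) :
    HasFDerivAt (fun y : EuclideanSpace ℝ (Fin N) => y i)
      (EuclideanSpace.proj i : EuclideanSpace ℝ (Fin N) →L[ℝ] ℝ) x :=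
  (EuclideanSpace.proj i : EuclideanSpace ℝ (Fin N) →L[ℝ] ℝ).hasFDerivAt

lemma partialDeriv_coord (i j : Fin N) (x : EuclideanSpace ℝ (Fin N)) :
    partialDeriv i (fun y => y j) x = if i = j then 1 else 0 := by
  simp [partialDeriv, (hasFDerivAt_coord j x).fderiv, eq_comm]

lemma eulerDeriv_coord (j : Fin N) (x : EuclideanSpace ℝ (Fin N)) :
    eulerDeriv (fun y => y j) x = x j := by
  simp [eulerDeriv, (hasFDerivAt_coord j x).fderiv]

lemma contDiff_partialDeriv (i : Fin N) (hf : ContDiff ℝ ∞ f) :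
    ContDiff ℝ ∞ (partialDeriv i f) :=
  (hf.fderiv_right (m := ∞) (by simp)).clm_apply contDiff_const

lemma contDiff_eulerDeriv (hf : ContDiff ℝ ∞ f) : ContDiff ℝ ∞ (eulerDeriv f) :=
  (hf.fderiv_right (m := ∞) (by simp)).clm_apply contDiff_id

lemma partialDeriv_comm (i j : Fin N) (hf : ContDiff ℝ ∞ f) (x : EuclideanSpace ℝ (Fin N)) :
    partialDeriv i (partialDeriv j f) x = partialDeriv j (partialDeriv i f) x := by
  have hd : DifferentiableAt ℝ (fderiv ℝ f) x :=
    ((hf.fderiv_right (m := ∞) (by simp)).differentiable (by simp)) x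
  have hs : IsSymmSndFDerivAt ℝ f x := hf.contDiffAt.isSymmSndFDerivAt
    (by simpa using WithTop.coe_le_coe.2 (le_top (a := (2 : ℕ∞))))
  have key : ∀ v w : EuclideanSpace ℝ (Fin N),
      fderiv ℝ (fun y => fderiv ℝ f y v) x w = fderiv ℝ (fderiv ℝ f) x w v := fun v w => by
    rw [fderiv_clm_apply hd (differentiableAt_const v)]
    simp
  change fderiv ℝ (fun y => fderiv ℝ f y _) x _ = fderiv ℝ (fun y => fderiv ℝ f y _) x _
  rw [key, key, hs.eq]

lemma partialDeriv_eulerDeriv (i : Fin N) (hf : ContDiff ℝ ∞ f)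
    (x : EuclideanSpace ℝ (Fin N)) :
    partialDeriv i (eulerDeriv f) x = eulerDeriv (partialDeriv i f) x + partialDeriv i f x := by
  have hd : DifferentiableAt ℝ (fderiv ℝ f) x :=
    ((hf.fderiv_right (m := ∞) (by simp)).differentiable (by simp)) x
  have hs : IsSymmSndFDerivAt ℝ f x := hf.contDiffAt.isSymmSndFDerivAt
    (by simpa using WithTop.coe_le_coe.2 (le_top (a := (2 : ℕ∞))))
  change fderiv ℝ (fun y => fderiv ℝ f y y) x _
    = fderiv ℝ (fun y => fderiv ℝ f y _) x _ + fderiv ℝ f x _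
  rw [fderiv_clm_apply hd differentiableAt_fun_id, fderiv_clm_apply hd (differentiableAt_const _)]
  simp [hs.eq, add_comm]

lemma laplacian_eq_sum_partialDeriv (hf : ContDiff ℝ ∞ f) (x : EuclideanSpace ℝ (Fin N)) :
    Laplacian.laplacian f x = ∑ i, partialDeriv i (partialDeriv i f) x := by
  rw [InnerProductSpace.laplacian_eq_iteratedFDeriv_orthonormalBasis f
    (EuclideanSpace.basisFun (Fin N) ℝ)]
  refine Finset.sum_congr rfl fun i _ => ?_
  have hd : DifferentiableAt ℝ (fderiv ℝ f) x :=
    ((hf.fderiv_right (m := ∞) (by simp)).differentiable (by simp)) x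
  change _ = fderiv ℝ (fun y => fderiv ℝ f y _) x _
  rw [iteratedFDeriv_two_apply, fderiv_clm_apply hd (differentiableAt_const _)]
  simp

lemma tsupport_partialDeriv_subset (i : Fin N) (f : EuclideanSpace ℝ (Fin N) → ℝ) :
    tsupport (partialDeriv i f) ⊆ tsupport f := by
  refine closure_minimal (fun x hx => ?_) (isClosed_tsupport f)
  refine support_fderiv_subset ℝ (f := f) fun h => hx ?_
  simp [partialDeriv, h]

lemma tsupport_eulerDeriv_subset (f : EuclideanSpace ℝ (Fin N) → ℝ) :
    tsupport (eulerDeriv f) ⊆ tsupport f := by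
  refine closure_minimal (fun x hx => ?_) (isClosed_tsupport f)
  refine support_fderiv_subset ℝ (f := f) fun h => hx ?_
  simp [eulerDeriv, h]

end Rules

/-! ### Test functions and integration by parts -/

namespace IsTestOn

variable {N : ℕ} {U : Set (EuclideanSpace ℝ (Fin N))} {f g : EuclideanSpace ℝ (Fin N) → ℝ}

lemma differentiableAt (hf : IsTestOn U f) (x : EuclideanSpace ℝ (Fin N)) :
    DifferentiableAt ℝ f x :=
  hf.contDiff.differentiable (by simp) x

lemma integrable (hf : IsTestOn U f) : Integrable f :=
  hf.contDiff.continuous.integrable_of_hasCompactSupport hf.compact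

lemma of_tsupport_subset (hf : IsTestOn U f) (hg : ContDiff ℝ ∞ g)
    (h : tsupport g ⊆ tsupport f) : IsTestOn U g :=
  ⟨hg, hf.compact.of_isClosed_subset (isClosed_tsupport g) h, h.trans hf.subset⟩

lemma pderiv (hf : IsTestOn U f) (i : Fin N) : IsTestOn U (partialDeriv i f) :=
  hf.of_tsupport_subset (contDiff_partialDeriv i hf.contDiff) (tsupport_partialDeriv_subset i f)

lemma euler (hf : IsTestOn U f) : IsTestOn U (eulerDeriv f) :=
  hf.of_tsupport_subset (contDiff_eulerDeriv hf.contDiff) (tsupport_eulerDeriv_subset f)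

lemma add (hf : IsTestOn U f) (hg : IsTestOn U g) : IsTestOn U (fun x => f x + g x) :=
  ⟨hf.contDiff.add hg.contDiff, hf.compact.add hg.compact,
    (tsupport_add f g).trans (Set.union_subset hf.subset hg.subset)⟩

/-- Smoothness of the weight on `U` suffices because the product vanishes near every point outside
the support of `f`. This admits weights singular at the origin or on the unit sphere. -/
lemma weight_mul {w : EuclideanSpace ℝ (Fin N) → ℝ} (hf : IsTestOn U f) (hU : IsOpen U)
    (hw : ContDiffOn ℝ ∞ w U) : IsTestOn U (fun x => w x * f x) := by
  have hsub : tsupport (fun x => w x * f x) ⊆ tsupport f := tsupport_mul_subset_right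
  refine hf.of_tsupport_subset (contDiff_iff_contDiffAt.2 fun x => ?_) hsub
  by_cases hx : x ∈ tsupport fun x => w x * f x
  swap
  · exact contDiffAt_const.congr_of_eventuallyEq (notMem_tsupport_iff_eventuallyEq.1 hx)
  exact (hw.contDiffAt (hU.mem_nhds (hf.subset (hsub hx)))).mul hf.contDiff.contDiffAt

lemma smooth_mul {w : EuclideanSpace ℝ (Fin N) → ℝ} (hf : IsTestOn U f)
    (hw : ContDiff ℝ ∞ w) : IsTestOn U (fun x => w x * f x) :=
  hf.of_tsupport_subset (hw.mul hf.contDiff) tsupport_mul_subset_right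

lemma const_mul (hf : IsTestOn U f) (c : ℝ) : IsTestOn U (fun x => c * f x) :=
  hf.smooth_mul contDiff_const

lemma mul (hf : IsTestOn U f) (hg : IsTestOn U g) : IsTestOn U (fun x => f x * g x) :=
  hg.smooth_mul hf.contDiff

lemma sq (hf : IsTestOn U f) : IsTestOn U (fun x => f x ^ 2) := by
  simpa only [pow_two] using hf.mul hf

lemma sub (hf : IsTestOn U f) (hg : IsTestOn U g) : IsTestOn U (fun x => f x - g x) := by
  simpa [sub_eq_add_neg] using hf.add (hg.const_mul (-1))

lemma sum {ι : Type*} {s : Finset ι} {F : ι → EuclideanSpace ℝ (Fin N) → ℝ}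
    (hF : ∀ i ∈ s, IsTestOn U (F i)) : IsTestOn U (fun x => ∑ i ∈ s, F i x) := by
  classical
  induction s using Finset.induction_on with
  | empty => exact ⟨by simpa using contDiff_const, HasCompactSupport.zero (β := ℝ),
      by simp [tsupport, Function.support]⟩
  | insert a s ha ih =>
    simp only [Finset.sum_insert ha]
    exact (hF a (Finset.mem_insert_self a s)).add
      (ih fun i hi => hF i (Finset.mem_insert_of_mem hi))

lemma integral_partialDeriv_eq_zero (hf : IsTestOn U f) (i : Fin N) :
    ∫ x, partialDeriv i f x = 0 := by
  have h := integral_mul_fderiv_eq_neg_fderiv_mul_of_integrable (μ := volume)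
    (f := fun _ : EuclideanSpace ℝ (Fin N) => (1 : ℝ)) (g := f)
    (v := EuclideanSpace.single i 1) (by simp)
    (by simpa using! (hf.pderiv i).integrable) (by simpa using hf.integrable)
    (fun x _ => differentiableAt_const _) (fun x _ => hf.differentiableAt x)
  simpa using! h

lemma integral_mul_partialDeriv (hf : IsTestOn U f) (hg : IsTestOn U g) (i : Fin N) :
    ∫ x, f x * partialDeriv i g x = -∫ x, partialDeriv i f x * g x := by
  have h := (hf.mul hg).integral_partialDeriv_eq_zero i
  simp only [partialDeriv_mul i (hf.differentiableAt _) (hg.differentiableAt _)] at h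
  rw [integral_add (hf.mul (hg.pderiv i)).integrable
    (hg.mul (hf.pderiv i)).integrable] at h
  simp only [mul_comm (g _)] at h
  linarith

/-- E f = div(f x) - N f, and the divergence of a compactly supported field integrates to zero. -/
lemma integral_eulerDeriv (hf : IsTestOn U f) :
    ∫ x, eulerDeriv f x = -(N * ∫ x, f x) := by
  have hc : ∀ i : Fin N, ContDiff ℝ ∞ fun y : EuclideanSpace ℝ (Fin N) => y i := fun i =>
    (EuclideanSpace.proj i : EuclideanSpace ℝ (Fin N) →L[ℝ] ℝ).contDiff
  have h : ∀ i : Fin N, ∫ x, x i * partialDeriv i f x = -∫ x, f x := fun i => by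
    have h0 := (hf.smooth_mul (hc i)).integral_partialDeriv_eq_zero i
    simp only [partialDeriv_mul i ((hc i).differentiable (by simp) _) (hf.differentiableAt _),
      partialDeriv_coord, if_true, mul_one] at h0
    rw [integral_add ((hf.pderiv i).smooth_mul (hc i)).integrable hf.integrable] at h0
    linarith
  simp only [← sum_coord_mul_partialDeriv]
  rw [integral_finsetSum _ fun i _ => ((hf.pderiv i).smooth_mul (hc i)).integrable]
  simp [h]

end IsTestOn

/-- The squared norm of the Hessian and the square of the Laplacian have the same integral. -/
lemma IsTestOn.integral_laplacian_sq {N : ℕ} {U : Set (EuclideanSpace ℝ (Fin N))}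
    {u : EuclideanSpace ℝ (Fin N) → ℝ} (hu : IsTestOn U u) :
    ∫ x, (∑ i, partialDeriv i (partialDeriv i u) x) ^ 2
      = ∫ x, ∑ i, ∑ j, partialDeriv i (partialDeriv j u) x ^ 2 := by
  have hij : ∀ i j : Fin N,
      ∫ x, partialDeriv i (partialDeriv i u) x * partialDeriv j (partialDeriv j u) x
        = ∫ x, partialDeriv i (partialDeriv j u) x ^ 2 := fun i j => by
    -- Moving ∂ᵢ off one factor, commuting it with ∂ⱼ, and moving ∂ⱼ back onto the other factor
    -- turns ∂ⱼⱼu ∂ᵢᵢu into (∂ᵢⱼu)².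
    have h1 := ((hu.pderiv j).pderiv j).integral_mul_partialDeriv (hu.pderiv i) i
    have h2 := ((hu.pderiv j).pderiv i).integral_mul_partialDeriv (hu.pderiv i) j
    have h3 : partialDeriv i (partialDeriv j (partialDeriv j u))
        = partialDeriv j (partialDeriv i (partialDeriv j u)) :=
      funext fun x => partialDeriv_comm i j (hu.pderiv j).contDiff x
    calc _ = ∫ x, partialDeriv j (partialDeriv j u) x * partialDeriv i (partialDeriv i u) x := by
          simp only [mul_comm]
      _ = ∫ x, partialDeriv i (partialDeriv j u) x * partialDeriv j (partialDeriv i u) x := by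
          rw [h1, h2, h3]
      _ = _ := by simp only [partialDeriv_comm j i hu.contDiff, pow_two]
  simp only [pow_two (Finset.sum _ _), Finset.sum_mul_sum]
  have hI : ∀ i j : Fin N, Integrable fun x =>
      partialDeriv i (partialDeriv i u) x * partialDeriv j (partialDeriv j u) x := fun i j =>
    (((hu.pderiv i).pderiv i).mul ((hu.pderiv j).pderiv j)).integrable
  have hJ : ∀ i j : Fin N, Integrable fun x => partialDeriv i (partialDeriv j u) x ^ 2 :=
    fun i j => ((hu.pderiv j).pderiv i).sq.integrable
  rw [integral_finsetSum _ fun i _ => integrable_finsetSum _ fun j _ => hI i j,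
    integral_finsetSum _ fun i _ => integrable_finsetSum _ fun j _ => hJ i j]
  refine Finset.sum_congr rfl fun i _ => ?_
  rw [integral_finsetSum _ fun j _ => hI i j, integral_finsetSum _ fun j _ => hJ i j]
  exact Finset.sum_congr rfl fun j _ => hij i j

/-! ### Radial weights on the punctured ball -/

/-- The open unit ball without its centre. -/
def puncturedBall (N : ℕ) : Set (EuclideanSpace ℝ (Fin N)) := Metric.ball 0 1 \ {0}

lemma isOpen_puncturedBall (N : ℕ) : IsOpen (puncturedBall N) :=
  Metric.isOpen_ball.sdiff isClosed_singleton

/-- The weight `|x|⁻²`. -/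
noncomputable def invSq {N : ℕ} (x : EuclideanSpace ℝ (Fin N)) : ℝ := (‖x‖ ^ 2)⁻¹

/-- The radial function `(1 - γ |x|ᵃ)⁻¹`. -/
noncomputable def hardyFactor {N : ℕ} (γ a : ℝ) (x : EuclideanSpace ℝ (Fin N)) : ℝ :=
  (1 - γ * ‖x‖ ^ a)⁻¹

section Weights

variable {N : ℕ} {x : EuclideanSpace ℝ (Fin N)} {γ a : ℝ}

lemma ne_zero_of_mem_puncturedBall (hx : x ∈ puncturedBall N) : x ≠ 0 := hx.2

lemma norm_lt_one_of_mem_puncturedBall (hx : x ∈ puncturedBall N) : ‖x‖ < 1 := by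
  simpa using hx.1

lemma norm_sq_eq_sum_coord (x : EuclideanSpace ℝ (Fin N)) : ‖x‖ ^ 2 = ∑ i, x i ^ 2 := by
  simp [EuclideanSpace.norm_sq_eq]

lemma invSq_mul_sum_coord (hx : x ≠ 0) : invSq x * ∑ i, x i ^ 2 = 1 := by
  rw [← norm_sq_eq_sum_coord, invSq, inv_mul_cancel₀]
  simpa using hx

lemma invSq_nonneg (x : EuclideanSpace ℝ (Fin N)) : 0 ≤ invSq x := by
  unfold invSq
  positivity

lemma contDiffAt_invSq (hx : x ≠ 0) : ContDiffAt ℝ ∞ (invSq (N := N)) x :=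
  (contDiff_norm_sq ℝ).contDiffAt.inv (by simpa using hx)

lemma contDiffOn_invSq : ContDiffOn ℝ ∞ (invSq (N := N)) (puncturedBall N) :=
  fun _ hx => (contDiffAt_invSq (ne_zero_of_mem_puncturedBall hx)).contDiffWithinAt

lemma differentiableAt_invSq (hx : x ≠ 0) : DifferentiableAt ℝ (invSq (N := N)) x :=
  (contDiffAt_invSq hx).differentiableAt (by simp)

lemma fderiv_invSq_apply (hx : x ≠ 0) (v : EuclideanSpace ℝ (Fin N)) :
    fderiv ℝ (invSq (N := N)) x v = -2 * inner ℝ x v * invSq x ^ 2 := by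
  have h : HasFDerivAt (fun y : EuclideanSpace ℝ (Fin N) => ‖y‖ ^ 2) _ x :=
    (hasStrictFDerivAt_norm_sq x).hasFDerivAt
  have hn : ‖x‖ ^ 2 ≠ 0 := by simpa using hx
  change fderiv ℝ (fun y : EuclideanSpace ℝ (Fin N) => (‖y‖ ^ 2)⁻¹) x v = _
  have h' := ((hasDerivAt_inv hn).comp_hasFDerivAt x h).fderiv
  change fderiv ℝ ((fun r : ℝ => r⁻¹) ∘ fun y : EuclideanSpace ℝ (Fin N) => ‖y‖ ^ 2) x v = _
  erw [h']
  simp [invSq]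
  ring

lemma partialDeriv_invSq (hx : x ≠ 0) (i : Fin N) :
    partialDeriv i (invSq (N := N)) x = -2 * x i * invSq x ^ 2 := by
  simp [partialDeriv, fderiv_invSq_apply hx, EuclideanSpace.inner_single_right]

lemma eulerDeriv_invSq (hx : x ≠ 0) : eulerDeriv (invSq (N := N)) x = -2 * invSq x := by
  have : ‖x‖ ≠ 0 := by simpa using hx
  rw [eulerDeriv, fderiv_invSq_apply hx, real_inner_self_eq_norm_sq, invSq]
  field_simp

lemma one_sub_mul_rpow_pos (hγ : γ ≤ 1) (ha : 0 < a) (hx : ‖x‖ < 1) :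
    0 < 1 - γ * ‖x‖ ^ a := by
  have h1 : ‖x‖ ^ a < 1 := Real.rpow_lt_one (norm_nonneg x) hx ha
  have h0 : 0 ≤ ‖x‖ ^ a := by positivity
  nlinarith [mul_le_mul_of_nonneg_right hγ h0]

lemma one_le_hardyFactor (hγ0 : 0 ≤ γ) (hγ : γ ≤ 1) (ha : 0 < a) (hx : ‖x‖ < 1) :
    1 ≤ hardyFactor γ a x := by
  refine (one_le_inv₀ (one_sub_mul_rpow_pos hγ ha hx)).2 ?_
  have : 0 ≤ γ * ‖x‖ ^ a := by positivity
  linarith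

lemma contDiffOn_hardyFactor (hγ : γ ≤ 1) (ha : 0 < a) :
    ContDiffOn ℝ ∞ (hardyFactor (N := N) γ a) (puncturedBall N) := fun x hx => by
  have hx0 := ne_zero_of_mem_puncturedBall hx
  refine ContDiffAt.contDiffWithinAt (ContDiffAt.inv ?_ ?_)
  · exact contDiffAt_const.sub (contDiffAt_const.mul
      ((contDiffAt_norm ℝ hx0).rpow_const_of_ne (by simpa using hx0)))
  · exact (one_sub_mul_rpow_pos hγ ha (norm_lt_one_of_mem_puncturedBall hx)).ne'

/-- E q = a γ|x|ᵃ q², and γ|x|ᵃ = 1 - 1/q. This Riccati equation is what lets the Hardy potentials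
close up. -/
lemma eulerDeriv_hardyFactor (hγ : γ ≤ 1) (ha : 0 < a) (hx : x ∈ puncturedBall N) :
    eulerDeriv (hardyFactor (N := N) γ a) x
      = a * (hardyFactor γ a x ^ 2 - hardyFactor γ a x) := by
  have hx0 := ne_zero_of_mem_puncturedBall hx
  have hn : ‖x‖ ≠ 0 := by simpa using hx0
  have hp := (one_sub_mul_rpow_pos hγ ha (norm_lt_one_of_mem_puncturedBall hx)).ne'
  have hd : DifferentiableAt ℝ (fun y : EuclideanSpace ℝ (Fin N) => ‖y‖) x :=
    (contDiffAt_norm ℝ hx0 (n := 1)).differentiableAt (by simp)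
  have h1 : HasDerivAt (fun r : ℝ => (1 - γ * r ^ a)⁻¹) _ ‖x‖ :=
    (((Real.hasDerivAt_rpow_const (p := a) (Or.inl hn)).const_mul γ).const_sub 1).fun_inv hp
  have h2 := (h1.comp_hasFDerivAt x hd.hasFDerivAt).fderiv
  have h3 : fderiv ℝ (fun y : EuclideanSpace ℝ (Fin N) => ‖y‖) x x = ‖x‖ := hd.fderiv_norm_self
  have h4 : ‖x‖ ^ (a - 1) * ‖x‖ = ‖x‖ ^ a := by
    rw [Real.rpow_sub_one hn, div_mul_cancel₀ _ hn]
  change fderiv ℝ ((fun r : ℝ => (1 - γ * r ^ a)⁻¹) ∘ fun y => ‖y‖) x x = _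
  rw [h2, smul_apply, h3, hardyFactor, smul_eq_mul, ← h4]
  rw [← h4] at hp
  field_simp
  ring

end Weights

/-! ### Weighted integration by parts and radial Hardy inequalities -/

section WeightedIdentities

variable {N : ℕ} {f g : EuclideanSpace ℝ (Fin N) → ℝ}

lemma IsTestOn.eq_zero_of_notMem {U : Set (EuclideanSpace ℝ (Fin N))} (hf : IsTestOn U f)
    {x : EuclideanSpace ℝ (Fin N)} (hx : x ∉ U) : f x = 0 :=
  image_eq_zero_of_notMem_tsupport fun h => hx (hf.subset h)

lemma IsTestOn.invSq_mul (hf : IsTestOn (puncturedBall N) f) :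
    IsTestOn (puncturedBall N) fun x => invSq x * f x :=
  hf.weight_mul (isOpen_puncturedBall N) contDiffOn_invSq

lemma IsTestOn.invSq_sq_mul (hf : IsTestOn (puncturedBall N) f) :
    IsTestOn (puncturedBall N) fun x => invSq x ^ 2 * f x :=
  hf.weight_mul (isOpen_puncturedBall N) (contDiffOn_invSq.pow 2)

/-- Integration by parts for the Euler operator with weight `|x|⁻²`. -/
lemma integral_invSq_mul_euler (hf : IsTestOn (puncturedBall N) f)
    (hg : IsTestOn (puncturedBall N) g) :
    (∫ x, invSq x * (f x * eulerDeriv g x)) + ∫ x, invSq x * (eulerDeriv f x * g x)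
      = -((N : ℝ) - 2) * ∫ x, invSq x * (f x * g x) := by
  have h := (hf.mul hg).invSq_mul.integral_eulerDeriv
  have hp : ∀ x, eulerDeriv (fun x => invSq x * (f x * g x)) x
      = invSq x * (f x * eulerDeriv g x) + invSq x * (eulerDeriv f x * g x)
        + -2 * (invSq x * (f x * g x)) := fun x => by
    -- The product rule for the weight is available only on the punctured ball; elsewhere every term
    -- vanishes with the test functions.
    by_cases hx : x ∈ puncturedBall N
    · have hx0 := ne_zero_of_mem_puncturedBall hx
      rw [eulerDeriv_mul (differentiableAt_invSq hx0) ((hf.mul hg).differentiableAt x),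
        eulerDeriv_mul (hf.differentiableAt x) (hg.differentiableAt x), eulerDeriv_invSq hx0]
      ring
    · simp [(hf.mul hg).invSq_mul.euler.eq_zero_of_notMem hx, hf.eq_zero_of_notMem hx,
        hg.eq_zero_of_notMem hx]
  have i1 := (hf.mul hg.euler).invSq_mul
  have i2 := (hf.euler.mul hg).invSq_mul
  have i3 := (hf.mul hg).invSq_mul
  simp only [hp] at h
  rw [integral_add (i1.add i2).integrable (i3.const_mul _).integrable,
    integral_add i1.integrable i2.integrable, integral_const_mul] at h
  linarith

/-- Integration by parts for the Euler operator with weight `|x|⁻⁴`. -/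
lemma integral_invSq_sq_mul_euler (hf : IsTestOn (puncturedBall N) f)
    (hg : IsTestOn (puncturedBall N) g) :
    (∫ x, invSq x ^ 2 * (f x * eulerDeriv g x)) + ∫ x, invSq x ^ 2 * (eulerDeriv f x * g x)
      = -((N : ℝ) - 4) * ∫ x, invSq x ^ 2 * (f x * g x) := by
  -- Absorbing the extra |x|⁻² into `g` shifts the constant by 2, since E|x|⁻² = -2|x|⁻².
  have h := integral_invSq_mul_euler hf hg.invSq_mul
  have hp : ∀ x, invSq x * (f x * eulerDeriv (fun x => invSq x * g x) x)
      = invSq x ^ 2 * (f x * eulerDeriv g x) + -2 * (invSq x ^ 2 * (f x * g x)) := fun x => by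
    by_cases hx : x ∈ puncturedBall N
    · have hx0 := ne_zero_of_mem_puncturedBall hx
      rw [eulerDeriv_mul (differentiableAt_invSq hx0) (hg.differentiableAt x),
        eulerDeriv_invSq hx0]
      ring
    · simp [hf.eq_zero_of_notMem hx]
  have e1 : ∀ a b c : ℝ, a * (b * (a * c)) = a ^ 2 * (b * c) := fun a b c => by ring
  simp only [hp, e1] at h
  rw [integral_add (hf.mul hg.euler).invSq_sq_mul.integrable
    ((hf.mul hg).invSq_sq_mul.const_mul _).integrable, integral_const_mul] at h
  linarith

/-- A weighted Hardy inequality in the radial direction, from a supersolution with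
logarithmic Euler derivative `-b`. -/
lemma hardy_of_supersolution {U : Set (EuclideanSpace ℝ (Fin N))} (hU : IsOpen U)
    (hf : IsTestOn U f) {b c h : EuclideanSpace ℝ (Fin N) → ℝ} (hb : ContDiffOn ℝ ∞ b U)
    (hc : ContDiffOn ℝ ∞ c U) (hh : ContDiffOn ℝ ∞ h U) (hc0 : ∀ x ∈ U, 0 ≤ c x)
    (hle : ∀ x ∈ U, h x ≤ N * (c x * b x) + eulerDeriv (fun y => c y * b y) x - c x * b x ^ 2) :
    ∫ x, h x * f x ^ 2 ≤ ∫ x, c x * eulerDeriv f x ^ 2 := by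
  have hF := hf.sq.weight_mul hU (hc.mul hb)
  have ih := hf.sq.weight_mul hU hh
  have ic := hf.euler.sq.weight_mul hU hc
  have hE := hF.integral_eulerDeriv
  -- Expand c (E f + b f)² ≥ 0. The cross term is c b E(f²), and adding the null integral of E(c b
  -- f²) + N c b f² trades it for the zeroth-order potential bounded below in `hle`.
  have key : 0 ≤ ∫ x, (c x * eulerDeriv f x ^ 2 - h x * f x ^ 2)
      + (eulerDeriv (fun x => c x * b x * f x ^ 2) x + N * (c x * b x * f x ^ 2)) := by
    refine integral_nonneg fun x => ?_
    change 0 ≤ (c x * eulerDeriv f x ^ 2 - h x * f x ^ 2)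
      + (eulerDeriv (fun x => c x * b x * f x ^ 2) x + N * (c x * b x * f x ^ 2))
    by_cases hx : x ∈ U
    · have hdc : DifferentiableAt ℝ (fun y => c y * b y) x :=
        ((hc.mul hb).contDiffAt (hU.mem_nhds hx)).differentiableAt (by simp)
      rw [eulerDeriv_mul hdc (hf.sq.differentiableAt x)]
      simp only [pow_two (f _)]
      rw [eulerDeriv_mul (hf.differentiableAt x) (hf.differentiableAt x)]
      nlinarith [mul_nonneg (hc0 x hx) (sq_nonneg (eulerDeriv f x + b x * f x)),
        mul_le_mul_of_nonneg_right (hle x hx) (mul_self_nonneg (f x))]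
    · rw [hf.euler.eq_zero_of_notMem hx, hF.euler.eq_zero_of_notMem hx, hf.eq_zero_of_notMem hx]
      simp
  rw [integral_add (ic.sub ih).integrable (hF.euler.add (hF.const_mul _)).integrable,
    integral_sub ic.integrable ih.integrable,
    integral_add hF.euler.integrable (hF.const_mul _).integrable, integral_const_mul, hE] at key
  linarith

/-- The improved Hardy inequality on the unit ball with weight `|x|⁻²`. -/
lemma improved_hardy {m : ℝ} (hm : (N : ℝ) - 2 = 2 * m) (hm0 : 0 < m) {γ : ℝ} (hγ : γ ≤ 1)
    (hf : IsTestOn (puncturedBall N) f) :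
    ∫ x, m ^ 2 * hardyFactor γ m x * invSq x * f x ^ 2 ≤ ∫ x, invSq x * eulerDeriv f x ^ 2 := by
  have hq := contDiffOn_hardyFactor (N := N) hγ hm0
  -- For φ = |x|⁻ᵐ - γ one has E φ = -m q φ, hence b = m q. By the Riccati equation the potential is
  -- exactly m² q |x|⁻², so equality holds.
  refine hardy_of_supersolution (isOpen_puncturedBall N) hf (b := fun x => m * hardyFactor γ m x)
    (contDiffOn_const.mul hq) contDiffOn_invSq ((contDiffOn_const.mul hq).mul contDiffOn_invSq)
    (fun x _ => invSq_nonneg x) fun x hx => le_of_eq ?_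
  have hx0 := ne_zero_of_mem_puncturedBall hx
  have hd : DifferentiableAt ℝ (hardyFactor (N := N) γ m) x :=
    (hq.contDiffAt ((isOpen_puncturedBall N).mem_nhds hx)).differentiableAt (by simp)
  rw [eulerDeriv_mul (differentiableAt_invSq hx0) (hd.const_mul m),
    eulerDeriv_mul (differentiableAt_const m) hd, eulerDeriv_hardyFactor hγ hm0 hx,
    eulerDeriv_invSq hx0]
  have hN : (N : ℝ) = 2 * m + 2 := by linarith
  have : eulerDeriv (fun _ : EuclideanSpace ℝ (Fin N) => m) x = 0 := by simp [eulerDeriv]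
  rw [hN, this]
  ring

/-- The Hardy inequality with weight `(m² (1 - γ |x|ᵐ)⁻¹ + β) |x|⁻⁴`. -/
lemma improved_hardy_invSq_sq {k m β γ : ℝ} (hk : (N : ℝ) - 4 = 2 * k) (hk0 : 0 < k)
    (hm0 : 0 < m) (hβ : 0 ≤ β) (hγ0 : 0 ≤ γ) (hγ : γ ≤ 1)
    (hf : IsTestOn (puncturedBall N) f) :
    ∫ x, k ^ 2 * ((m ^ 2 * hardyFactor γ m x + β) * invSq x ^ 2 * hardyFactor 1 k x) * f x ^ 2
      ≤ ∫ x, (m ^ 2 * hardyFactor γ m x + β) * invSq x ^ 2 * eulerDeriv f x ^ 2 := by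
  have hq := contDiffOn_hardyFactor (N := N) hγ hm0
  have hp := contDiffOn_hardyFactor (N := N) le_rfl hk0
  have hw := ((contDiffOn_const (c := m ^ 2)).mul hq).add (contDiffOn_const (c := β))
  have hc := hw.mul (contDiffOn_invSq.pow 2)
  -- Here φ = |x|⁻ᵏ - 1. The derivative of |x|⁻⁴ replaces N by N - 4 = 2k, as in the previous case.
  refine hardy_of_supersolution (isOpen_puncturedBall N) hf (b := fun x => k * hardyFactor 1 k x)
    (contDiffOn_const.mul hp) hc (contDiffOn_const.mul (hc.mul hp)) (fun x hx => ?_)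
    fun x hx => ?_
  · have := one_le_hardyFactor hγ0 hγ hm0 (norm_lt_one_of_mem_puncturedBall hx)
    positivity
  have hx0 := ne_zero_of_mem_puncturedBall hx
  have hnhds := (isOpen_puncturedBall N).mem_nhds hx
  have hdq : DifferentiableAt ℝ (hardyFactor (N := N) γ m) x :=
    (hq.contDiffAt hnhds).differentiableAt (by simp)
  have hdp : DifferentiableAt ℝ (hardyFactor (N := N) 1 k) x :=
    (hp.contDiffAt hnhds).differentiableAt (by simp)
  have hdr := differentiableAt_invSq hx0
  have hdw : DifferentiableAt ℝ (fun y => m ^ 2 * hardyFactor γ m y + β) x :=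
    (hdq.const_mul _).add_const _
  have hdrr : DifferentiableAt ℝ (fun y : EuclideanSpace ℝ (Fin N) => invSq y * invSq y) x :=
    hdr.mul hdr
  have hdwr : DifferentiableAt ℝ
      (fun y => (m ^ 2 * hardyFactor γ m y + β) * (invSq y * invSq y)) x := hdw.mul hdrr
  have hconst : ∀ d : ℝ, eulerDeriv (fun _ : EuclideanSpace ℝ (Fin N) => d) x = 0 := by
    simp [eulerDeriv]
  have hE : eulerDeriv (fun y => (m ^ 2 * hardyFactor γ m y + β) * invSq y ^ 2
        * (k * hardyFactor 1 k y)) x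
      = (m ^ 2 * hardyFactor γ m x + β) * invSq x ^ 2 * (k * eulerDeriv (hardyFactor 1 k) x)
        + k * hardyFactor 1 k x * ((m ^ 2 * hardyFactor γ m x + β) * (-4 * invSq x ^ 2)
          + invSq x ^ 2 * (m ^ 2 * eulerDeriv (hardyFactor γ m) x)) := by
    simp only [pow_two (invSq _)]
    rw [eulerDeriv_mul hdwr (hdp.const_mul k),
      eulerDeriv_mul (differentiableAt_const k) hdp, eulerDeriv_mul hdw hdrr,
      eulerDeriv_mul hdr hdr, eulerDeriv_add (hdq.const_mul _) (differentiableAt_const β),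
      eulerDeriv_mul (differentiableAt_const _) hdq, hconst, hconst, hconst, eulerDeriv_invSq hx0]
    ring
  have hq1 := one_le_hardyFactor hγ0 hγ hm0 (norm_lt_one_of_mem_puncturedBall hx)
  have hp1 := one_le_hardyFactor zero_le_one le_rfl hk0 (norm_lt_one_of_mem_puncturedBall hx)
  rw [hE, eulerDeriv_hardyFactor le_rfl hk0 hx, eulerDeriv_hardyFactor hγ hm0 hx]
  have hN : (N : ℝ) = 2 * k + 4 := by linarith
  rw [hN]
  -- The surplus over the claimed potential comes from differentiating q in the weight; it is
  -- nonnegative because q ≥ 1.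
  have hpos : 0 ≤ k * hardyFactor 1 k x * (invSq x ^ 2 * (m ^ 2 * (m *
      (hardyFactor γ m x * (hardyFactor γ m x - 1))))) := by
    have : 0 ≤ hardyFactor γ m x - 1 := by linarith
    positivity
  linear_combination hpos

end WeightedIdentities

/-! ### Trace inequality for the tangential Hessian -/

/-- The part of a symmetric matrix `H` orthogonal to `x` satisfies the trace inequality in
dimension `N - 1`; here `ρ = |x|⁻²`. -/
lemma sq_trace_sub_le {N : ℕ} (hN : 2 ≤ N) (H : Fin N → Fin N → ℝ)
    (hH : ∀ i j, H i j = H j i) (x w : Fin N → ℝ) (ρ A : ℝ) (hρ : ρ * ∑ i, x i ^ 2 = 1)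
    (hw : ∀ i, w i = ∑ j, x j * H j i) (hA : A = ∑ i, x i * w i) :
    ((∑ i, H i i) - ρ * A) ^ 2 ≤
      ((N : ℝ) - 1) * ((∑ i, ∑ j, H i j ^ 2) - 2 * ρ * (∑ i, w i ^ 2) + ρ ^ 2 * A ^ 2) := by
  set R := ∑ i, x i ^ 2 with hR
  set W := ∑ i, w i ^ 2 with hW
  set L := ∑ i, H i i with hL
  have hN' : (0 : ℝ) < (N : ℝ) - 1 := by
    have : (2 : ℝ) ≤ N := by exact_mod_cast hN
    linarith
  -- This is the squared Frobenius norm of H - ρ(x⊗w + w⊗x) + β x⊗x - τ I, with β and τ still free.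
  have expand : ∀ β τ : ℝ, 0 ≤ (∑ i, ∑ j, H i j ^ 2) - 4 * ρ * W + 2 * β * A - 2 * τ * L
      + ρ ^ 2 * (2 * (R * W) + 2 * A ^ 2) - 4 * ρ * β * (R * A) + 4 * ρ * τ * A
      + β ^ 2 * R ^ 2 - 2 * β * τ * R + τ ^ 2 * N := fun β τ => by
    have h0 : 0 ≤ ∑ i, ∑ j, (H i j - ρ * (x i * w j + w i * x j) + β * (x i * x j)
        - τ * (if i = j then 1 else 0)) ^ 2 :=
      Finset.sum_nonneg fun i _ => Finset.sum_nonneg fun j _ => sq_nonneg _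
    have hs : ∀ i j, (H i j - ρ * (x i * w j + w i * x j) + β * (x i * x j)
        - τ * (if i = j then 1 else 0)) ^ 2
        = H i j ^ 2 + (-2 * ρ) * (w j * (x i * H i j)) + (-2 * ρ) * (w i * (x j * H j i))
          + (2 * β) * (x j * (x i * H i j)) + ρ ^ 2 * (x i ^ 2 * w j ^ 2)
          + ρ ^ 2 * (w i ^ 2 * x j ^ 2) + (2 * ρ ^ 2) * ((x i * w i) * (x j * w j))
          + (-2 * ρ * β) * (x i ^ 2 * (x j * w j)) + (-2 * ρ * β) * ((x i * w i) * x j ^ 2)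
          + β ^ 2 * (x i ^ 2 * x j ^ 2)
          + (if i = j then -2 * τ * H i i + 4 * ρ * τ * (x i * w i) - 2 * β * τ * x i ^ 2 + τ ^ 2
              else 0) := fun i j => by
      rw [hH j i]
      split_ifs with h
      · subst h
        ring
      · ring
    simp only [hs, Finset.sum_add_distrib, ← Finset.mul_sum, Finset.sum_ite_eq, Finset.mem_univ,
      if_true, ← Finset.sum_mul, Finset.sum_sub_distrib, Finset.sum_const, Finset.card_univ,
      Fintype.card_fin, nsmul_eq_mul, ← hw, ← hA, ← hR, ← hL] at h0
    have e1 : ∑ i, ∑ j, w j * (x i * H i j) = W := by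
      rw [Finset.sum_comm]
      simp only [← Finset.mul_sum, ← hw, hW, pow_two]
    have e2 : ∑ i, ∑ j, x j * (x i * H i j) = A := by
      rw [Finset.sum_comm]
      simp only [← Finset.mul_sum, ← hw, hA]
    have e3 : ∑ i, w i * w i = W := by simp only [hW, pow_two]
    rw [e1, e2, e3, ← hW] at h0
    linarith
  -- With P = I - ρ x⊗x the tangential projection, this β makes the matrix PHP - τP, and τ =
  -- tr(PHP)/(N - 1) is the optimal multiple, since tr P = N - 1.
  have key := expand (ρ ^ 2 * A + ρ * ((L - ρ * A) / (N - 1))) ((L - ρ * A) / (N - 1))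
  set τ := (L - ρ * A) / ((N : ℝ) - 1) with hτ
  have hτ' : L - ρ * A = τ * (N - 1) := by
    rw [hτ, div_mul_cancel₀ _ hN'.ne']
  have hred : 0 ≤ (∑ i, ∑ j, H i j ^ 2) - 2 * ρ * W + ρ ^ 2 * A ^ 2 - τ ^ 2 * (N - 1) := by
    have e : (∑ i, ∑ j, H i j ^ 2) - 2 * ρ * W + ρ ^ 2 * A ^ 2 - τ ^ 2 * (N - 1)
        = (∑ i, ∑ j, H i j ^ 2) - 4 * ρ * W + 2 * (ρ ^ 2 * A + ρ * τ) * A - 2 * τ * L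
      + ρ ^ 2 * (2 * (R * W) + 2 * A ^ 2) - 4 * ρ * (ρ ^ 2 * A + ρ * τ) * (R * A) + 4 * ρ * τ * A
      + (ρ ^ 2 * A + ρ * τ) ^ 2 * R ^ 2 - 2 * (ρ ^ 2 * A + ρ * τ) * τ * R + τ ^ 2 * N := by
      have hLe : L = τ * (N - 1) + ρ * A := by linarith
      rw [hLe]
      linear_combination (-2 * ρ * W + 4 * ρ * A * (ρ * A + τ) + 2 * (ρ * A + τ) * τ
        - (ρ * A + τ) ^ 2 * (ρ * R + 1)) * hρ
    rw [e]
    exact key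
  rw [hτ']
  nlinarith [mul_nonneg hN'.le hred]

/-! ### Rellich inequalities away from the origin -/

section Rellich

variable {N : ℕ} {u : EuclideanSpace ℝ (Fin N) → ℝ}

/-- The second Euler derivative `x · D²u x`, as the Euler derivative of `x · ∇u - u`. -/
noncomputable def radialHessian (u : EuclideanSpace ℝ (Fin N) → ℝ) :
    EuclideanSpace ℝ (Fin N) → ℝ :=
  eulerDeriv fun x => eulerDeriv u x - u x

lemma IsTestOn.radialHessian {U : Set (EuclideanSpace ℝ (Fin N))} (hu : IsTestOn U u) :
    IsTestOn U (radialHessian u) :=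
  (hu.euler.sub hu).euler

/-- Since ∂ᵢE = E∂ᵢ + ∂ᵢ, subtracting u removes the commutator. -/
lemma partialDeriv_eulerDeriv_sub {U : Set (EuclideanSpace ℝ (Fin N))} (hu : IsTestOn U u)
    (i : Fin N) :
    partialDeriv i (fun x => eulerDeriv u x - u x) = eulerDeriv (partialDeriv i u) := by
  ext x
  rw [partialDeriv_sub i (hu.euler.differentiableAt x) (hu.differentiableAt x),
    partialDeriv_eulerDeriv i hu.contDiff]
  ring

lemma radialHessian_eq_sum {U : Set (EuclideanSpace ℝ (Fin N))} (hu : IsTestOn U u)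
    (x : EuclideanSpace ℝ (Fin N)) :
    radialHessian u x = ∑ i, x i * eulerDeriv (partialDeriv i u) x := by
  simp only [← partialDeriv_eulerDeriv_sub hu, sum_coord_mul_partialDeriv]
  rfl

lemma radialHessian_eq {U : Set (EuclideanSpace ℝ (Fin N))} (hu : IsTestOn U u)
    (x : EuclideanSpace ℝ (Fin N)) :
    radialHessian u x = eulerDeriv (eulerDeriv u) x - eulerDeriv u x :=
  eulerDeriv_sub (hu.euler.differentiableAt x) (hu.differentiableAt x)

lemma partialDeriv_radialHessian {U : Set (EuclideanSpace ℝ (Fin N))} (hu : IsTestOn U u)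
    (i : Fin N) (x : EuclideanSpace ℝ (Fin N)) :
    partialDeriv i (radialHessian u) x
      = eulerDeriv (eulerDeriv (partialDeriv i u)) x + eulerDeriv (partialDeriv i u) x := by
  rw [radialHessian, partialDeriv_eulerDeriv i (hu.euler.sub hu).contDiff,
    partialDeriv_eulerDeriv_sub hu]

/-- Move one ∂ᵢ off ∂ᵢᵢu. Where it hits the radial Hessian, the |x|⁻² Euler identity for ∂ᵢu reduces
the result to squares. Where it hits |x|⁻², summation over i leaves |x|⁻⁴ times the radial Hessian
times E u, handled by the |x|⁻⁴ identity. -/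
lemma integral_radialHessian_mul_laplacian (hu : IsTestOn (puncturedBall N) u) :
    ∫ x, invSq x * (radialHessian u x * ∑ i, partialDeriv i (partialDeriv i u) x)
      = -((N : ℝ) - 2) * (∫ x, invSq x ^ 2 * eulerDeriv u x ^ 2)
        + (∫ x, invSq x * ∑ i, eulerDeriv (partialDeriv i u) x ^ 2)
        - ((N : ℝ) - 2) * (N - 3) / 2 * ∫ x, invSq x * ∑ i, partialDeriv i u x ^ 2 := by
  have hD := hu.pderiv
  have hs := hu.euler
  have hA := hu.radialHessian
  have step : ∀ i, ∫ x, invSq x * (radialHessian u x * partialDeriv i (partialDeriv i u) x)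
      = (∫ x, 2 * (invSq x ^ 2 * (radialHessian u x * (x i * partialDeriv i u x))))
        + (∫ x, invSq x * eulerDeriv (partialDeriv i u) x ^ 2)
        - ((N : ℝ) - 2) * (N - 3) / 2 * ∫ x, invSq x * partialDeriv i u x ^ 2 := fun i => by
    have hc : ContDiff ℝ ∞ fun y : EuclideanSpace ℝ (Fin N) => y i :=
      (EuclideanSpace.proj i : EuclideanSpace ℝ (Fin N) →L[ℝ] ℝ).contDiff
    have h1 := hA.invSq_mul.integral_mul_partialDeriv (hD i) i
    have hp : ∀ x, partialDeriv i (fun x => invSq x * radialHessian u x) x * partialDeriv i u x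
        = invSq x * (partialDeriv i u x * eulerDeriv (eulerDeriv (partialDeriv i u)) x)
          + invSq x * (partialDeriv i u x * eulerDeriv (partialDeriv i u) x)
          + -1 * (2 * (invSq x ^ 2 * (radialHessian u x * (x i * partialDeriv i u x)))) :=
      fun x => by
      by_cases hx : x ∈ puncturedBall N
      · have hx0 := ne_zero_of_mem_puncturedBall hx
        rw [partialDeriv_mul i (differentiableAt_invSq hx0) (hA.differentiableAt x),
          partialDeriv_radialHessian hu, partialDeriv_invSq hx0]
        ring
      · simp [(hD i).eq_zero_of_notMem hx]
    have i1 := ((hD i).mul (hD i).euler.euler).invSq_mul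
    have i2 := ((hD i).mul (hD i).euler).invSq_mul
    have i3 := ((hA.mul ((hD i).smooth_mul hc)).invSq_sq_mul).const_mul 2
    simp only [hp] at h1
    rw [integral_add (i1.add i2).integrable (i3.const_mul _).integrable,
      integral_add i1.integrable i2.integrable, integral_const_mul (-1)] at h1
    have h2 := integral_invSq_mul_euler (hD i) (hD i)
    have h3 := integral_invSq_mul_euler (hD i) (hD i).euler
    simp only [mul_comm (eulerDeriv (partialDeriv i u) _) (partialDeriv i u _)] at h2
    simp only [← pow_two] at h2 h3
    simp only [mul_assoc] at h1
    rw [h1]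
    linear_combination ((N : ℝ) - 3) / 2 * h2 - h3
  have j1 : ∀ i, IsTestOn (puncturedBall N) fun x =>
      2 * (invSq x ^ 2 * (radialHessian u x * (x i * partialDeriv i u x))) := fun i =>
    ((hA.mul ((hD i).smooth_mul (EuclideanSpace.proj i :
      EuclideanSpace ℝ (Fin N) →L[ℝ] ℝ).contDiff)).invSq_sq_mul).const_mul 2
  simp only [Finset.mul_sum]
  rw [integral_finsetSum _ fun i _ => (hA.mul ((hD i).pderiv i)).invSq_mul.integrable,
    integral_finsetSum _ fun i _ => (hD i).euler.sq.invSq_mul.integrable,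
    integral_finsetSum _ fun i _ => (hD i).sq.invSq_mul.integrable]
  simp only [step, Finset.sum_sub_distrib, Finset.sum_add_distrib, ← Finset.mul_sum]
  rw [← integral_finsetSum _ fun i _ => (j1 i).integrable]
  simp only [← Finset.mul_sum, sum_coord_mul_partialDeriv]
  have hp2 : ∀ x, 2 * (invSq x ^ 2 * (radialHessian u x * eulerDeriv u x))
      = 2 * (invSq x ^ 2 * (eulerDeriv u x * eulerDeriv (eulerDeriv u) x))
        - 2 * (invSq x ^ 2 * eulerDeriv u x ^ 2) := fun x => by
    rw [radialHessian_eq hu]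
    ring
  simp only [hp2]
  rw [integral_sub ((hs.mul hs.euler).invSq_sq_mul.const_mul 2).integrable
    (hs.sq.invSq_sq_mul.const_mul 2).integrable, integral_const_mul, integral_const_mul]
  have h4 := integral_invSq_sq_mul_euler hs hs
  simp only [mul_comm (eulerDeriv (eulerDeriv u) _) (eulerDeriv u _)] at h4
  simp only [← pow_two] at h4
  linear_combination h4

/-- The Hardy inequality for the tangential part of the gradient. -/
lemma two_mul_integral_tangential_le (hN : 5 ≤ N) (hu : IsTestOn (puncturedBall N) u) :
    2 * ((∫ x, invSq x * ∑ i, partialDeriv i u x ^ 2) - ∫ x, invSq x ^ 2 * eulerDeriv u x ^ 2)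
      ≤ (∫ x, invSq x * ∑ i, eulerDeriv (partialDeriv i u) x ^ 2)
        - ∫ x, invSq x ^ 2 * radialHessian u x ^ 2 := by
  have hD := hu.pderiv
  have hs := hu.euler
  have hA := hu.radialHessian
  have hN' : (5 : ℝ) ≤ N := by exact_mod_cast hN
  have hc : ∀ i : Fin N, ContDiff ℝ ∞ fun y : EuclideanSpace ℝ (Fin N) => y i := fun i =>
    (EuclideanSpace.proj i : EuclideanSpace ℝ (Fin N) →L[ℝ] ℝ).contDiff
  -- These are the components of the tangential gradient. As E commutes with the projection
  -- orthogonal to x, `hqE` gives the tangential part of D²u x.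
  have hq : ∀ i, IsTestOn (puncturedBall N)
      fun x => partialDeriv i u x - x i * (invSq x * eulerDeriv u x) := fun i =>
    (hD i).sub (hs.invSq_mul.smooth_mul (hc i))
  have hqE : ∀ i, ∀ x ∈ puncturedBall N,
      eulerDeriv (fun x => partialDeriv i u x - x i * (invSq x * eulerDeriv u x)) x
        = eulerDeriv (partialDeriv i u) x - x i * (invSq x * radialHessian u x) :=
    fun i x hx => by
    have hx0 := ne_zero_of_mem_puncturedBall hx
    rw [eulerDeriv_sub ((hD i).differentiableAt x)
        ((hs.invSq_mul.smooth_mul (hc i)).differentiableAt x),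
      eulerDeriv_mul ((hc i).differentiable (by simp) x) (hs.invSq_mul.differentiableAt x),
      eulerDeriv_mul (differentiableAt_invSq hx0) (hs.differentiableAt x), eulerDeriv_coord,
      eulerDeriv_invSq hx0, radialHessian_eq hu]
    ring
  have hardy : ∀ i, ∫ x, 2 * (invSq x
      * (partialDeriv i u x - x i * (invSq x * eulerDeriv u x)) ^ 2)
      ≤ ∫ x, invSq x
        * eulerDeriv (fun x => partialDeriv i u x - x i * (invSq x * eulerDeriv u x)) x ^ 2 :=
    fun i => by
    -- At γ = 0 the factor q is 1, and the Hardy constant ((N - 2)/2)² ≥ 9/4 exceeds 2.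
    refine le_trans ?_ (improved_hardy (m := ((N : ℝ) - 2) / 2) (by ring) (by linarith)
      (γ := 0) zero_le_one (hq i))
    refine integral_mono ((hq i).sq.invSq_mul.const_mul 2).integrable ?_ fun x => ?_
    · have : IsTestOn (puncturedBall N) _ := (hq i).sq.invSq_mul.const_mul ((((N : ℝ) - 2) / 2) ^ 2)
      simpa [hardyFactor, mul_assoc] using this.integrable
    · simp only [hardyFactor, zero_mul, sub_zero, inv_one, mul_one, mul_assoc]
      refine mul_le_mul_of_nonneg_right (by nlinarith)
        (mul_nonneg (invSq_nonneg x) (sq_nonneg _))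
  have hsum := Finset.sum_le_sum fun i (_ : i ∈ Finset.univ) => hardy i
  rw [← integral_finsetSum _ fun i _ => ((hq i).sq.invSq_mul.const_mul 2).integrable,
    ← integral_finsetSum _ fun i _ => (hq i).euler.sq.invSq_mul.integrable] at hsum
  have e1 : ∀ x, ∑ i, 2 * (invSq x * (partialDeriv i u x - x i * (invSq x * eulerDeriv u x)) ^ 2)
      = 2 * (invSq x * ∑ i, partialDeriv i u x ^ 2)
        - 2 * (invSq x ^ 2 * eulerDeriv u x ^ 2) := fun x => by
    by_cases hx : x ∈ puncturedBall N
    · have h1 := invSq_mul_sum_coord (ne_zero_of_mem_puncturedBall hx)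
      have h2 := sum_coord_mul_partialDeriv u x
      have : ∀ i, 2 * (invSq x * (partialDeriv i u x - x i * (invSq x * eulerDeriv u x)) ^ 2)
          = 2 * (invSq x * partialDeriv i u x ^ 2)
            - 4 * (invSq x ^ 2 * eulerDeriv u x) * (x i * partialDeriv i u x)
            + 2 * (invSq x ^ 3 * eulerDeriv u x ^ 2) * x i ^ 2 := fun i => by ring
      simp only [this, Finset.sum_add_distrib, Finset.sum_sub_distrib, ← Finset.mul_sum, h2]
      linear_combination 2 * invSq x ^ 2 * eulerDeriv u x ^ 2 * h1
    · simp [hs.eq_zero_of_notMem hx, (hD _).eq_zero_of_notMem hx]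
  have e2 : ∀ x, ∑ i, invSq x
      * eulerDeriv (fun x => partialDeriv i u x - x i * (invSq x * eulerDeriv u x)) x ^ 2
      = invSq x * (∑ i, eulerDeriv (partialDeriv i u) x ^ 2)
        - invSq x ^ 2 * radialHessian u x ^ 2 := fun x => by
    by_cases hx : x ∈ puncturedBall N
    · have h1 := invSq_mul_sum_coord (ne_zero_of_mem_puncturedBall hx)
      have h2 := (radialHessian_eq_sum hu x).symm
      have : ∀ i, invSq x
          * (eulerDeriv (partialDeriv i u) x - x i * (invSq x * radialHessian u x)) ^ 2
          = invSq x * eulerDeriv (partialDeriv i u) x ^ 2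
            - 2 * (invSq x ^ 2 * radialHessian u x) * (x i * eulerDeriv (partialDeriv i u) x)
            + (invSq x ^ 3 * radialHessian u x ^ 2) * x i ^ 2 := fun i => by ring
      simp only [hqE _ x hx, this, Finset.sum_add_distrib, Finset.sum_sub_distrib,
        ← Finset.mul_sum, h2]
      linear_combination invSq x ^ 2 * radialHessian u x ^ 2 * h1
    · simp [(hq _).euler.eq_zero_of_notMem hx, hA.eq_zero_of_notMem hx,
        (hD _).euler.eq_zero_of_notMem hx]
  simp only [e1, e2] at hsum
  rw [integral_sub ((IsTestOn.sum fun i _ => (hD i).sq).invSq_mul.const_mul 2).integrable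
      (hs.sq.invSq_sq_mul.const_mul 2).integrable,
    integral_sub (IsTestOn.sum fun i _ => (hD i).euler.sq).invSq_mul.integrable
      hA.sq.invSq_sq_mul.integrable, integral_const_mul, integral_const_mul] at hsum
  linarith

/-- The Rellich inequality `∫ |Δu|² ≥ ∫ (W + (N - 1) |x|⁻²) |∇u|²` away from the origin, where
`W = m² |x|⁻² (1 - γ |x|ᵐ)⁻¹` and `m = (N - 2) / 2`. -/
lemma rellich_gradient (hN : 5 ≤ N) {m : ℝ} (hm : (N : ℝ) - 2 = 2 * m) {γ : ℝ}
    (hγ : γ ≤ 1) (hu : IsTestOn (puncturedBall N) u) :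
    ∫ x, (m ^ 2 * hardyFactor γ m x + ((N : ℝ) - 1)) * (invSq x * ∑ i, partialDeriv i u x ^ 2)
      ≤ ∫ x, (∑ i, partialDeriv i (partialDeriv i u) x) ^ 2 := by
  have hD := hu.pderiv
  have hs := hu.euler
  have hA := hu.radialHessian
  have hN' : (5 : ℝ) ≤ N := by exact_mod_cast hN
  have hm0 : 0 < m := by linarith
  have hL : IsTestOn (puncturedBall N) fun x => ∑ i, partialDeriv i (partialDeriv i u) x :=
    .sum fun i _ => (hD i).pderiv i
  have hH : IsTestOn (puncturedBall N) fun x => ∑ i, ∑ j, partialDeriv i (partialDeriv j u) x ^ 2 :=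
    .sum fun i _ => .sum fun j _ => ((hD j).pderiv i).sq
  have hW : IsTestOn (puncturedBall N) fun x => ∑ i, eulerDeriv (partialDeriv i u) x ^ 2 :=
    .sum fun i _ => (hD i).euler.sq
  have hG : IsTestOn (puncturedBall N) fun x => ∑ i, partialDeriv i u x ^ 2 :=
    .sum fun i _ => (hD i).sq
  have bochner := hu.integral_laplacian_sq
  have pointwise : ∫ x, ((∑ i, partialDeriv i (partialDeriv i u) x) ^ 2
      - 2 * (invSq x * (radialHessian u x * ∑ i, partialDeriv i (partialDeriv i u) x)))
        + invSq x ^ 2 * radialHessian u x ^ 2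
      ≤ ∫ x, ((N : ℝ) - 1) * (((∑ i, ∑ j, partialDeriv i (partialDeriv j u) x ^ 2)
        - 2 * (invSq x * ∑ i, eulerDeriv (partialDeriv i u) x ^ 2))
        + invSq x ^ 2 * radialHessian u x ^ 2) := by
    refine integral_mono ((hL.sq.sub ((hA.mul hL).invSq_mul.const_mul 2)).add
      hA.sq.invSq_sq_mul).integrable (((hH.sub (hW.invSq_mul.const_mul 2)).add
      hA.sq.invSq_sq_mul).const_mul _).integrable fun x => ?_
    simp only
    by_cases hx : x ∈ puncturedBall N
    · have h := sq_trace_sub_le (by omega : 2 ≤ N) (fun i j => partialDeriv i (partialDeriv j u) x)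
        (fun i j => partialDeriv_comm i j hu.contDiff x) (fun i => x i)
        (fun i => eulerDeriv (partialDeriv i u) x) (invSq x) (radialHessian u x)
        (invSq_mul_sum_coord (ne_zero_of_mem_puncturedBall hx))
        (fun i => (sum_coord_mul_partialDeriv _ x).symm) (radialHessian_eq_sum hu x)
      linarith
    · simp [hA.eq_zero_of_notMem hx, hL.eq_zero_of_notMem hx, hH.eq_zero_of_notMem hx,
        hW.eq_zero_of_notMem hx]
  rw [integral_add (hL.sq.sub ((hA.mul hL).invSq_mul.const_mul 2)).integrable
      hA.sq.invSq_sq_mul.integrable,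
    integral_sub hL.sq.integrable ((hA.mul hL).invSq_mul.const_mul 2).integrable,
    integral_const_mul, integral_const_mul,
    integral_add (hH.sub (hW.invSq_mul.const_mul 2)).integrable hA.sq.invSq_sq_mul.integrable,
    integral_sub hH.integrable (hW.invSq_mul.const_mul 2).integrable, integral_const_mul,
    ← bochner, integral_radialHessian_mul_laplacian hu] at pointwise
  have tangential := two_mul_integral_tangential_le hN hu
  have hq : ContDiffOn ℝ ∞ (fun x => m ^ 2 * hardyFactor (N := N) γ m x) (puncturedBall N) :=
    contDiffOn_const.mul (contDiffOn_hardyFactor hγ hm0)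
  have hw : ∀ {f : EuclideanSpace ℝ (Fin N) → ℝ}, IsTestOn (puncturedBall N) f →
      IsTestOn (puncturedBall N) fun x => m ^ 2 * hardyFactor γ m x * (invSq x * f x) :=
    fun hf => hf.invSq_mul.weight_mul (isOpen_puncturedBall N) hq
  have hardy : ∫ x, m ^ 2 * hardyFactor γ m x * (invSq x * ∑ i, partialDeriv i u x ^ 2)
      ≤ ∫ x, invSq x * ∑ i, eulerDeriv (partialDeriv i u) x ^ 2 := by
    simp only [Finset.mul_sum]
    rw [integral_finsetSum _ fun i _ => (hw (hD i).sq).integrable,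
      integral_finsetSum _ fun i _ => (hD i).euler.sq.invSq_mul.integrable]
    refine Finset.sum_le_sum fun i _ => ?_
    simpa only [mul_assoc] using improved_hardy hm hm0 hγ (hD i)
  simp only [add_mul]
  rw [integral_add (hw hG).integrable (hG.invSq_mul.const_mul _).integrable, integral_const_mul]
  set IL := ∫ x, (∑ i, partialDeriv i (partialDeriv i u) x) ^ 2
  set S := ∫ x, invSq x ^ 2 * eulerDeriv u x ^ 2
  set W := ∫ x, invSq x * ∑ i, eulerDeriv (partialDeriv i u) x ^ 2
  set G := ∫ x, invSq x * ∑ i, partialDeriv i u x ^ 2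
  set A := ∫ x, invSq x ^ 2 * radialHessian u x ^ 2
  have h2 : 0 < (N : ℝ) - 2 := by linarith
  -- In the integrated trace inequality every term carries a factor N - 2. After division, 2(G - S)
  -- ≤ W - A eliminates both S and A, leaving IL ≥ W + (N - 1) G.
  have h3 : ((N : ℝ) - 2) * (2 * W - A + 2 * S + (N - 3) * G) ≤ (N - 2) * IL := by linarith
  have h4 := le_of_mul_le_mul_left h3 h2
  linarith

/-- The weighted Rellich inequality for functions supported away from the origin. -/
lemma rellich_punctured (hN : 5 ≤ N) {m k : ℝ} (hm : (N : ℝ) - 2 = 2 * m)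
    (hk : (N : ℝ) - 4 = 2 * k) {γ : ℝ} (hγ0 : 0 ≤ γ) (hγ : γ ≤ 1)
    (hu : IsTestOn (puncturedBall N) u) :
    ∫ x, k ^ 2 * ((m ^ 2 * hardyFactor γ m x + ((N : ℝ) - 1)) * invSq x ^ 2 * hardyFactor 1 k x)
        * u x ^ 2
      ≤ ∫ x, (∑ i, partialDeriv i (partialDeriv i u) x) ^ 2 := by
  have hN' : (5 : ℝ) ≤ N := by exact_mod_cast hN
  have hm0 : 0 < m := by linarith
  have hG : IsTestOn (puncturedBall N) fun x => ∑ i, partialDeriv i u x ^ 2 :=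
    .sum fun i _ => (hu.pderiv i).sq
  have hw : ContDiffOn ℝ ∞ (fun x => m ^ 2 * hardyFactor (N := N) γ m x + ((N : ℝ) - 1))
      (puncturedBall N) :=
    (contDiffOn_const.mul (contDiffOn_hardyFactor hγ hm0)).add contDiffOn_const
  refine (improved_hardy_invSq_sq hk (by linarith) hm0 (by linarith) hγ0 hγ hu).trans
    (le_trans ?_ (rellich_gradient hN hm hγ hu))
  refine integral_mono
    (hu.euler.sq.weight_mul (isOpen_puncturedBall N) (hw.mul (contDiffOn_invSq.pow 2))).integrable
    (hG.invSq_mul.weight_mul (isOpen_puncturedBall N) hw).integrable fun x => ?_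
  simp only
  by_cases hx : x ∈ puncturedBall N
  · have hq := one_le_hardyFactor hγ0 hγ hm0 (norm_lt_one_of_mem_puncturedBall hx)
    have hcs := Finset.sum_mul_sq_le_sq_mul_sq Finset.univ (fun i => x i)
      (fun i => partialDeriv i u x)
    rw [sum_coord_mul_partialDeriv] at hcs
    have h1 := invSq_mul_sum_coord (ne_zero_of_mem_puncturedBall hx)
    have hw0 : 0 ≤ m ^ 2 * hardyFactor γ m x + ((N : ℝ) - 1) := by
      have : 0 ≤ m ^ 2 * hardyFactor γ m x := by positivity
      linarith
    rw [mul_assoc]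
    refine mul_le_mul_of_nonneg_left ?_ hw0
    calc invSq x ^ 2 * eulerDeriv u x ^ 2
        ≤ invSq x ^ 2 * ((∑ i, x i ^ 2) * ∑ i, partialDeriv i u x ^ 2) := by gcongr
      _ = invSq x * ∑ i, partialDeriv i u x ^ 2 := by
        linear_combination (invSq x * ∑ i, partialDeriv i u x ^ 2) * h1
  · simp [hu.euler.eq_zero_of_notMem hx, hG.eq_zero_of_notMem hx]

end Rellich

/-! ### Cutoff at the origin -/

section Cutoff

variable {N : ℕ}

/-- A smooth function vanishing on the ball of radius `1 / n` and equal to one off the ball of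
radius `2 / n`. -/
noncomputable def originCutoff (N n : ℕ) (x : EuclideanSpace ℝ (Fin N)) : ℝ :=
  1 - (⟨1, 2, one_pos, one_lt_two⟩ : ContDiffBump (0 : EuclideanSpace ℝ (Fin N))) ((n : ℝ) • x)

lemma contDiff_originCutoff (n : ℕ) : ContDiff ℝ ∞ (originCutoff N n) :=
  contDiff_const.sub ((ContDiffBump.contDiff _).comp (contDiff_const_smul (n : ℝ)))

lemma originCutoff_nonneg (n : ℕ) (x : EuclideanSpace ℝ (Fin N)) : 0 ≤ originCutoff N n x :=
  sub_nonneg.2 (ContDiffBump.le_one _)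

lemma originCutoff_le_one (n : ℕ) (x : EuclideanSpace ℝ (Fin N)) : originCutoff N n x ≤ 1 :=
  sub_le_self _ (ContDiffBump.nonneg _)

lemma originCutoff_eventuallyEq_zero (n : ℕ) :
    originCutoff N n =ᶠ[nhds 0] fun _ => 0 := by
  have hc : Filter.Tendsto (fun x : EuclideanSpace ℝ (Fin N) => (n : ℝ) • x) (nhds 0) (nhds 0) := by
    simpa using (continuous_const_smul (n : ℝ)).tendsto (0 : EuclideanSpace ℝ (Fin N))
  filter_upwards [hc.eventually (ContDiffBump.eventuallyEq_one _)] with x hx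
  rw [originCutoff, hx]
  simp

lemma originCutoff_eventuallyEq_one {x : EuclideanSpace ℝ (Fin N)} {n : ℕ}
    (hx : 2 < n * ‖x‖) : originCutoff N n =ᶠ[nhds x] fun _ => 1 := by
  have hc : Continuous fun y : EuclideanSpace ℝ (Fin N) => (n : ℝ) * ‖y‖ := by fun_prop
  filter_upwards [hc.continuousAt.eventually (lt_mem_nhds hx)] with y hy
  rw [originCutoff, ContDiffBump.zero_of_le_dist, sub_zero]
  simpa [norm_smul] using hy.le

lemma partialDeriv_comp_smul (f : EuclideanSpace ℝ (Fin N) → ℝ) (c : ℝ)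
    (i : Fin N) (x : EuclideanSpace ℝ (Fin N)) :
    partialDeriv i (fun y => f (c • y)) x = c * partialDeriv i f (c • x) := by
  rw [partialDeriv, fderiv_comp_smul]
  simp [partialDeriv]

lemma partialDeriv_const_mul {f : EuclideanSpace ℝ (Fin N) → ℝ} (hf : ContDiff ℝ ∞ f) (c : ℝ)
    (i : Fin N) (x : EuclideanSpace ℝ (Fin N)) :
    partialDeriv i (fun y => c * f y) x = c * partialDeriv i f x := by
  simp [partialDeriv, fderiv_const_mul (hf.differentiable (by simp) x)]

/-- Scale invariance: up to sign, each quantity is a fixed compactly supported function of y = n x,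
namely |y| ∂ᵢη or |y|² ∂ᵢᵢη in absolute value, so the bound is independent of n. -/
lemma exists_originCutoff_bounds (i : Fin N) : ∃ C : ℝ, ∀ (n : ℕ) (x : EuclideanSpace ℝ (Fin N)),
    ‖x‖ * |partialDeriv i (originCutoff N n) x| ≤ C ∧
      ‖x‖ ^ 2 * |partialDeriv i (partialDeriv i (originCutoff N n)) x| ≤ C := by
  set η : ContDiffBump (0 : EuclideanSpace ℝ (Fin N)) := ⟨1, 2, one_pos, one_lt_two⟩
  have hη : IsTestOn Set.univ η := ⟨η.contDiff, η.hasCompactSupport, Set.subset_univ _⟩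
  obtain ⟨C₁, h₁⟩ := ((hη.pderiv i).compact.mul_left
    (f := fun x => ‖x‖)).exists_bound_of_continuous
    (continuous_norm.mul (hη.pderiv i).contDiff.continuous)
  obtain ⟨C₂, h₂⟩ := (((hη.pderiv i).pderiv i).compact.mul_left
    (f := fun x => ‖x‖ ^ 2)).exists_bound_of_continuous
    ((continuous_norm.pow 2).mul ((hη.pderiv i).pderiv i).contDiff.continuous)
  have e₁ : ∀ n : ℕ, partialDeriv i (originCutoff N n)
      = fun x => -(n : ℝ) * partialDeriv i η ((n : ℝ) • x) := fun n => by
    ext x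
    have hd : ContDiff ℝ ∞ fun y : EuclideanSpace ℝ (Fin N) => η ((n : ℝ) • y) :=
      η.contDiff.comp (contDiff_const_smul _)
    change partialDeriv i (fun y => 1 - η ((n : ℝ) • y)) x = _
    rw [partialDeriv_sub i (differentiableAt_const _) (hd.differentiable (by simp) x),
      partialDeriv_comp_smul]
    simp [partialDeriv]
  have e₂ : ∀ n : ℕ, partialDeriv i (partialDeriv i (originCutoff N n))
      = fun x => -(n : ℝ) * (n * partialDeriv i (partialDeriv i η) ((n : ℝ) • x)) := fun n => by
    ext x
    have hd : ContDiff ℝ ∞ fun y : EuclideanSpace ℝ (Fin N) => partialDeriv i η ((n : ℝ) • y) :=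
      (hη.pderiv i).contDiff.comp (contDiff_const_smul _)
    rw [e₁, partialDeriv_const_mul hd, partialDeriv_comp_smul]
  refine ⟨max C₁ C₂, fun n x => ⟨le_max_of_le_left ?_, le_max_of_le_right ?_⟩⟩
  · refine le_trans (le_of_eq ?_) (h₁ ((n : ℝ) • x))
    rw [e₁]
    simp [norm_smul, abs_mul]
    ring
  · refine le_trans (le_of_eq ?_) (h₂ ((n : ℝ) • x))
    rw [e₂]
    simp [norm_smul, abs_mul]
    ring

variable {u : EuclideanSpace ℝ (Fin N) → ℝ}

lemma IsTestOn.originCutoff_mul (hu : IsTestOn (Metric.ball 0 1) u) (n : ℕ) :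
    IsTestOn (puncturedBall N) fun x => originCutoff N n x * u x := by
  have h := hu.smooth_mul (contDiff_originCutoff n)
  refine ⟨h.contDiff, h.compact, fun x hx => ⟨h.subset hx, ?_⟩⟩
  rintro rfl
  refine (notMem_tsupport_iff_eventuallyEq.2 ?_) hx
  filter_upwards [originCutoff_eventuallyEq_zero (N := N) n] with x hx
  simp [hx]

lemma partialDeriv_partialDeriv_mul {f g : EuclideanSpace ℝ (Fin N) → ℝ} (hf : ContDiff ℝ ∞ f)
    (hg : ContDiff ℝ ∞ g) (i : Fin N) (x : EuclideanSpace ℝ (Fin N)) :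
    partialDeriv i (partialDeriv i fun y => f y * g y) x
      = f x * partialDeriv i (partialDeriv i g) x + 2 * (partialDeriv i f x * partialDeriv i g x)
        + partialDeriv i (partialDeriv i f) x * g x := by
  have df : ∀ {h : EuclideanSpace ℝ (Fin N) → ℝ}, ContDiff ℝ ∞ h → ∀ y, DifferentiableAt ℝ h y :=
    fun hh y => hh.differentiable (by simp) y
  have hf' := contDiff_partialDeriv i hf
  have hg' := contDiff_partialDeriv i hg
  have e : (partialDeriv i fun y => f y * g y)
      = fun y => f y * partialDeriv i g y + g y * partialDeriv i f y :=
    funext fun y => partialDeriv_mul i (df hf y) (df hg y)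
  rw [e, partialDeriv_add i (df (hf.mul hg') x) (df (hg.mul hf') x),
    partialDeriv_mul i (df hf x) (df hg' x), partialDeriv_mul i (df hg x) (df hf' x)]
  ring

/-- The Laplacians of the truncations are bounded by `C |x|⁻²` uniformly. -/
lemma exists_laplacian_originCutoff_bound (hu : IsTestOn (Metric.ball 0 1) u) :
    ∃ C : ℝ, ∀ (n : ℕ), ∀ x ∈ Metric.ball (0 : EuclideanSpace ℝ (Fin N)) 1,
      ‖x‖ ^ 2 * |∑ i, partialDeriv i (partialDeriv i fun y => originCutoff N n y * u y) x| ≤ C := by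
  have hb : ∀ {f : EuclideanSpace ℝ (Fin N) → ℝ}, IsTestOn (Metric.ball 0 1) f →
      ∃ C : ℝ, ∀ x, |f x| ≤ C := fun hf =>
    hf.compact.exists_bound_of_continuous hf.contDiff.continuous
  obtain ⟨M₀, h₀⟩ := hb hu
  choose M₁ h₁ using fun i => hb (hu.pderiv i)
  choose M₂ h₂ using fun i => hb ((hu.pderiv i).pderiv i)
  choose C hC using exists_originCutoff_bounds (N := N)
  refine ⟨∑ i, (M₂ i + 2 * (C i * M₁ i) + C i * M₀), fun n x hx => ?_⟩
  have hx1 : ‖x‖ ≤ 1 := by simpa using (mem_ball_zero_iff.1 hx).le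
  refine (mul_le_mul_of_nonneg_left (Finset.abs_sum_le_sum_abs _ _) (by positivity)).trans ?_
  rw [Finset.mul_sum]
  refine Finset.sum_le_sum fun i _ => ?_
  rw [partialDeriv_partialDeriv_mul (contDiff_originCutoff n) hu.contDiff]
  obtain ⟨hc1, hc2⟩ := hC i n x
  have hC0 : 0 ≤ C i := le_trans (by positivity) hc1
  have a1 : ‖x‖ ^ 2 * |originCutoff N n x * partialDeriv i (partialDeriv i u) x| ≤ M₂ i := by
    rw [abs_mul, abs_of_nonneg (originCutoff_nonneg n x), ← mul_assoc]
    refine (mul_le_of_le_one_left (abs_nonneg _) ?_).trans (h₂ i x)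
    exact mul_le_one₀ (pow_le_one₀ (norm_nonneg x) hx1) (originCutoff_nonneg n x)
      (originCutoff_le_one n x)
  have a2 : ‖x‖ ^ 2 * |2 * (partialDeriv i (originCutoff N n) x * partialDeriv i u x)|
      ≤ 2 * (C i * M₁ i) := by
    have e : ‖x‖ ^ 2 * |2 * (partialDeriv i (originCutoff N n) x * partialDeriv i u x)|
        = 2 * (‖x‖ * (‖x‖ * |partialDeriv i (originCutoff N n) x| * |partialDeriv i u x|)) := by
      rw [abs_mul, abs_mul, abs_two]
      ring
    rw [e]
    refine mul_le_mul_of_nonneg_left ?_ zero_le_two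
    refine (mul_le_of_le_one_left (by positivity) hx1).trans ?_
    exact mul_le_mul hc1 (h₁ i x) (abs_nonneg _) hC0
  have a3 : ‖x‖ ^ 2 * |partialDeriv i (partialDeriv i (originCutoff N n)) x * u x|
      ≤ C i * M₀ := by
    rw [abs_mul, ← mul_assoc]
    exact mul_le_mul hc2 (h₀ x) (abs_nonneg _) hC0
  calc _ ≤ ‖x‖ ^ 2 * (|originCutoff N n x * partialDeriv i (partialDeriv i u) x|
        + |2 * (partialDeriv i (originCutoff N n) x * partialDeriv i u x)|
        + |partialDeriv i (partialDeriv i (originCutoff N n)) x * u x|) :=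
      mul_le_mul_of_nonneg_left (abs_add_three _ _ _) (by positivity)
    _ ≤ _ := by linarith

/-- In polar coordinates the integrand is rᴺ⁻¹ r⁻⁴ = rᴺ⁻⁵, continuous up to r = 0 because N ≥ 5. -/
lemma integrableOn_invSq_sq (hN : 5 ≤ N) :
    IntegrableOn (fun x => invSq x ^ 2) (Metric.ball (0 : EuclideanSpace ℝ (Fin N)) 1) := by
  have : Nonempty (Fin N) := ⟨⟨0, by omega⟩⟩
  refine (integrableOn_fun_norm_addHaar (volume : Measure (EuclideanSpace ℝ (Fin N)))
    (f := fun r : ℝ => ((r ^ 2)⁻¹) ^ 2)).2 ?_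
  have hcont : Continuous fun y : ℝ => y ^ (N - 5) := continuous_pow _
  refine (hcont.continuousOn.integrableOn_Icc.mono_set Set.Ioo_subset_Icc_self).congr_fun
    (fun y hy => ?_) measurableSet_Ioo
  have hy0 : y ≠ 0 := hy.1.ne'
  have : N - 1 = N - 5 + 4 := by omega
  simp only [finrank_euclideanSpace, Fintype.card_fin, smul_eq_mul, this, pow_add]
  field_simp

/-- Dominated convergence with majorant C²|x|⁻⁴: at each x ≠ 0 the truncation eventually agrees with
u near x, so no estimate of the cutoff error is needed, even for N = 5. -/
lemma tendsto_integral_laplacian_originCutoff (hN : 5 ≤ N) (hu : IsTestOn (Metric.ball 0 1) u) :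
    Filter.Tendsto (fun n : ℕ => ∫ x in Metric.ball (0 : EuclideanSpace ℝ (Fin N)) 1,
        (∑ i, partialDeriv i (partialDeriv i fun y => originCutoff N n y * u y) x) ^ 2)
      Filter.atTop (nhds (∫ x in Metric.ball (0 : EuclideanSpace ℝ (Fin N)) 1,
        (∑ i, partialDeriv i (partialDeriv i u) x) ^ 2)) := by
  obtain ⟨C, hC⟩ := exists_laplacian_originCutoff_bound hu
  have hne : ∀ᵐ x ∂(volume.restrict (Metric.ball (0 : EuclideanSpace ℝ (Fin N)) 1)), x ≠ 0 := by
    have : Nonempty (Fin N) := ⟨⟨0, by omega⟩⟩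
    exact ae_restrict_of_ae (Measure.ae_ne volume 0)
  refine tendsto_integral_of_dominated_convergence (fun x => C ^ 2 * invSq x ^ 2) (fun n => ?_)
    ((integrableOn_invSq_sq hN).const_mul _) (fun n => ?_) ?_
  · have h : IsTestOn (puncturedBall N) fun x =>
        ∑ i, partialDeriv i (partialDeriv i fun y => originCutoff N n y * u y) x :=
      .sum fun i _ => ((hu.originCutoff_mul n).pderiv i).pderiv i
    exact h.sq.contDiff.continuous.aestronglyMeasurable
  · filter_upwards [ae_restrict_mem Metric.isOpen_ball.measurableSet, hne] with x hx hx0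
    have hpos : 0 < ‖x‖ ^ 2 := by positivity
    rw [Real.norm_eq_abs, abs_pow, ← mul_pow]
    refine pow_le_pow_left₀ (abs_nonneg _) ?_ 2
    rw [invSq, ← div_eq_mul_inv, le_div_iff₀ hpos, mul_comm]
    exact hC n x hx
  · filter_upwards [hne] with x hx0
    refine tendsto_const_nhds.congr' ?_
    have hpos : 0 < ‖x‖ := by positivity
    filter_upwards [(tendsto_natCast_atTop_atTop.atTop_mul_const hpos).eventually_gt_atTop 2]
      with n hn
    have hone := originCutoff_eventuallyEq_one hn
    have e1 : ∀ i, (partialDeriv i fun y => originCutoff N n y * u y) =ᶠ[nhds x]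
        partialDeriv i u := fun i => by
      have : (fun y => originCutoff N n y * u y) =ᶠ[nhds x] u := by
        filter_upwards [hone] with y hy
        simp [hy]
      filter_upwards [this.fderiv (𝕜 := ℝ)] with y hy
      simp [partialDeriv, hy]
    congr 1
    refine Finset.sum_congr rfl fun i _ => ?_
    exact congrArg (fun L : _ →L[ℝ] ℝ => L (EuclideanSpace.single i 1)) (e1 i).fderiv_eq.symm

end Cutoff

/-! ### The inequality on the full ball -/

section Ball

variable {N : ℕ} {u : EuclideanSpace ℝ (Fin N) → ℝ}

lemma continuousOn_hardyFactor {γ a : ℝ} (hγ : γ ≤ 1) (ha : 0 < a) :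
    ContinuousOn (hardyFactor (N := N) γ a) (Metric.ball 0 1) := by
  have h : Continuous fun x : EuclideanSpace ℝ (Fin N) => 1 - γ * ‖x‖ ^ a :=
    continuous_const.sub (continuous_const.mul (continuous_norm.rpow_const fun _ => Or.inr ha.le))
  exact h.continuousOn.inv₀ fun x hx =>
    (one_sub_mul_rpow_pos hγ ha (mem_ball_zero_iff.1 hx)).ne'

/-- The support of u stays away from the unit sphere, where w may blow up, so w u² is bounded and
|x|⁻⁴ carries the only singularity. -/
lemma integrableOn_weight_mul_sq (hN : 5 ≤ N) (hu : IsTestOn (Metric.ball 0 1) u)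
    {w : EuclideanSpace ℝ (Fin N) → ℝ} (hw : ContinuousOn w (Metric.ball 0 1)) :
    IntegrableOn (fun x => w x * invSq x ^ 2 * u x ^ 2)
      (Metric.ball (0 : EuclideanSpace ℝ (Fin N)) 1) := by
  have hcont : Continuous fun x => w x * u x ^ 2 := by
    refine continuous_iff_continuousAt.2 fun x => ?_
    by_cases hx : x ∈ tsupport u
    · exact (hw.continuousAt (Metric.isOpen_ball.mem_nhds (hu.subset hx))).mul
        hu.sq.contDiff.continuous.continuousAt
    · refine continuousAt_const.congr (f := fun _ => (0 : ℝ)) ?_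
      filter_upwards [notMem_tsupport_iff_eventuallyEq.1 hx] with y hy
      simp [hy]
  obtain ⟨C, hC⟩ := (hu.sq.compact.mul_left (f := w)).exists_bound_of_continuous hcont
  have h := (integrableOn_invSq_sq hN).bdd_mul (f := fun x => w x * u x ^ 2)
    hcont.aestronglyMeasurable (ae_of_all _ hC)
  refine h.congr (ae_of_all _ fun x => ?_)
  simp only
  ring

/-- The weighted Rellich inequality on the unit ball. -/
lemma rellich_ball (hN : 5 ≤ N) {m k : ℝ} (hm : (N : ℝ) - 2 = 2 * m)
    (hk : (N : ℝ) - 4 = 2 * k) {γ : ℝ} (hγ0 : 0 ≤ γ) (hγ : γ ≤ 1)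
    (hu : IsTestOn (Metric.ball 0 1) u) :
    ∫ x in Metric.ball (0 : EuclideanSpace ℝ (Fin N)) 1,
      (k ^ 2 * ((m ^ 2 * hardyFactor γ m x + ((N : ℝ) - 1)) * hardyFactor 1 k x))
        * invSq x ^ 2 * u x ^ 2
      ≤ ∫ x in Metric.ball (0 : EuclideanSpace ℝ (Fin N)) 1,
        (∑ i, partialDeriv i (partialDeriv i u) x) ^ 2 := by
  have hN' : (5 : ℝ) ≤ N := by exact_mod_cast hN
  set w : EuclideanSpace ℝ (Fin N) → ℝ := fun x =>
    k ^ 2 * ((m ^ 2 * hardyFactor γ m x + ((N : ℝ) - 1)) * hardyFactor 1 k x) with hw_def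
  have hw : ContinuousOn w (Metric.ball 0 1) :=
    continuousOn_const.mul (((continuousOn_const.mul (continuousOn_hardyFactor hγ
      (by linarith))).add continuousOn_const).mul (continuousOn_hardyFactor le_rfl (by linarith)))
  have hI := integrableOn_weight_mul_sq hN hu hw
  have hne : ∀ᵐ x ∂(volume.restrict (Metric.ball (0 : EuclideanSpace ℝ (Fin N)) 1)), x ≠ 0 := by
    have : Nonempty (Fin N) := ⟨⟨0, by omega⟩⟩
    exact ae_restrict_of_ae (Measure.ae_ne volume 0)
  have hlim : Filter.Tendsto (fun n : ℕ => ∫ x in Metric.ball (0 : EuclideanSpace ℝ (Fin N)) 1,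
      originCutoff N n x ^ 2 * (w x * invSq x ^ 2 * u x ^ 2)) Filter.atTop
      (nhds (∫ x in Metric.ball (0 : EuclideanSpace ℝ (Fin N)) 1,
        w x * invSq x ^ 2 * u x ^ 2)) := by
    refine tendsto_integral_of_dominated_convergence (fun x => ‖w x * invSq x ^ 2 * u x ^ 2‖)
      (fun n => ((contDiff_originCutoff n).continuous.pow 2).aestronglyMeasurable.mul hI.1)
      hI.norm (fun n => ae_of_all _ fun x => ?_) ?_
    · rw [norm_mul, Real.norm_eq_abs (_ ^ 2), abs_of_nonneg (sq_nonneg _)]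
      exact mul_le_of_le_one_left (norm_nonneg _)
        (pow_le_one₀ (originCutoff_nonneg n x) (originCutoff_le_one n x))
    · filter_upwards [hne] with x hx0
      refine tendsto_const_nhds.congr' ?_
      have hpos : 0 < ‖x‖ := by positivity
      filter_upwards [(tendsto_natCast_atTop_atTop.atTop_mul_const hpos).eventually_gt_atTop 2]
        with n hn
      simp [(originCutoff_eventuallyEq_one hn).eq_of_nhds]
  -- The inequality for the truncations passes to the limit on both sides.
  refine le_of_tendsto_of_tendsto' hlim (tendsto_integral_laplacian_originCutoff hN hu)
    fun n => ?_
  have hn := hu.originCutoff_mul n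
  have hL : IsTestOn (puncturedBall N) fun x =>
      ∑ i, partialDeriv i (partialDeriv i fun y => originCutoff N n y * u y) x :=
    .sum fun i _ => (hn.pderiv i).pderiv i
  have h := rellich_punctured hN hm hk hγ0 hγ hn
  rw [setIntegral_eq_integral_of_forall_compl_eq_zero fun x hx => ?_,
    setIntegral_eq_integral_of_forall_compl_eq_zero fun x hx => ?_]
  · refine le_trans (le_of_eq ?_) h
    refine integral_congr_ae (ae_of_all _ fun x => ?_)
    simp only [hw_def]
    ring
  · exact hL.sq.eq_zero_of_notMem fun hx' => hx hx'.1
  · simp [hu.eq_zero_of_notMem hx]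

lemma norm_sq_sub_rpow {b a : ℝ} (hb : b = 2 + a) (ha : 0 < a) (γ : ℝ)
    (x : EuclideanSpace ℝ (Fin N)) :
    ‖x‖ ^ 2 - γ * ‖x‖ ^ b = ‖x‖ ^ 2 * (1 - γ * ‖x‖ ^ a) := by
  rw [hb, Real.rpow_add_of_nonneg (norm_nonneg x) zero_le_two ha.le, Real.rpow_two]
  ring

end Ball

theorem theorem2p2 (N : ℕ) (hN : 5 ≤ N)
    (u : EuclideanSpace ℝ (Fin N) → ℝ) (hu : ContDiff ℝ ∞ u)
    (hu_cpt : HasCompactSupport u)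
    (hu_supp : tsupport u ⊆ Metric.ball (0 : EuclideanSpace ℝ (Fin N)) 1) :
    IntegrableOn (fun x => (Laplacian.laplacian u x) ^ 2)
      (Metric.ball (0 : EuclideanSpace ℝ (Fin N)) 1) ∧
    IntegrableOn (fun x => u x ^ 2 /
        ((‖x‖ ^ 2 - (9 / 10 : ℝ) * ‖x‖ ^ ((N : ℝ) / 2 + 1)) *
          (‖x‖ ^ 2 - ‖x‖ ^ ((N : ℝ) / 2))))
      (Metric.ball (0 : EuclideanSpace ℝ (Fin N)) 1) ∧
    IntegrableOn (fun x => u x ^ 2 / (‖x‖ ^ 2 * (‖x‖ ^ 2 - ‖x‖ ^ ((N : ℝ) / 2))))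
      (Metric.ball (0 : EuclideanSpace ℝ (Fin N)) 1) ∧
    ((N : ℝ) - 2) ^ 2 * ((N : ℝ) - 4) ^ 2 / 16 *
        (∫ x in Metric.ball (0 : EuclideanSpace ℝ (Fin N)) 1,
          u x ^ 2 /
            ((‖x‖ ^ 2 - (9 / 10 : ℝ) * ‖x‖ ^ ((N : ℝ) / 2 + 1)) *
              (‖x‖ ^ 2 - ‖x‖ ^ ((N : ℝ) / 2)))) +
      ((N : ℝ) - 1) * ((N : ℝ) - 4) ^ 2 / 4 *
        (∫ x in Metric.ball (0 : EuclideanSpace ℝ (Fin N)) 1,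
          u x ^ 2 / (‖x‖ ^ 2 * (‖x‖ ^ 2 - ‖x‖ ^ ((N : ℝ) / 2)))) ≤
      (∫ x in Metric.ball (0 : EuclideanSpace ℝ (Fin N)) 1,
        (Laplacian.laplacian u x) ^ 2) ∧
    (N : ℝ) ^ 2 * ((N : ℝ) - 4) ^ 2 / 16 *
        (∫ x in Metric.ball (0 : EuclideanSpace ℝ (Fin N)) 1,
          u x ^ 2 / (‖x‖ ^ 2 * (‖x‖ ^ 2 - ‖x‖ ^ ((N : ℝ) / 2)))) ≤
      (∫ x in Metric.ball (0 : EuclideanSpace ℝ (Fin N)) 1,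
        (Laplacian.laplacian u x) ^ 2) := by
  have hN' : (5 : ℝ) ≤ N := by exact_mod_cast hN
  have hT : IsTestOn (Metric.ball 0 1) u := ⟨hu, hu_cpt, hu_supp⟩
  set m : ℝ := ((N : ℝ) - 2) / 2 with hm_def
  set k : ℝ := ((N : ℝ) - 4) / 2 with hk_def
  have hm0 : 0 < m := by linarith
  have hk0 : 0 < k := by linarith
  have hγ : (9 / 10 : ℝ) ≤ 1 := by norm_num
  have hL : IsTestOn (Metric.ball 0 1) fun x => ∑ i, partialDeriv i (partialDeriv i u) x :=
    .sum fun i _ => (hT.pderiv i).pderiv i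
  -- The exponents split as N/2 = 2 + k and N/2 + 1 = 2 + m, so each factor of the denominators
  -- releases a |x|².
  have hden2 : ∀ x : EuclideanSpace ℝ (Fin N),
      ‖x‖ ^ 2 - ‖x‖ ^ ((N : ℝ) / 2) = ‖x‖ ^ 2 * (1 - 1 * ‖x‖ ^ k) := fun x => by
    rw [← norm_sq_sub_rpow (by rw [hk_def]; ring : (N : ℝ) / 2 = 2 + k) hk0, one_mul]
  have e1 : ∀ x : EuclideanSpace ℝ (Fin N), u x ^ 2 /
      ((‖x‖ ^ 2 - (9 / 10 : ℝ) * ‖x‖ ^ ((N : ℝ) / 2 + 1)) * (‖x‖ ^ 2 - ‖x‖ ^ ((N : ℝ) / 2)))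
      = (hardyFactor (9 / 10) m x * hardyFactor 1 k x) * invSq x ^ 2 * u x ^ 2 := fun x => by
    rw [hden2, norm_sq_sub_rpow (by rw [hm_def]; ring : (N : ℝ) / 2 + 1 = 2 + m) hm0,
      div_eq_mul_inv, mul_inv, mul_inv, mul_inv, hardyFactor, hardyFactor, invSq]
    ring
  have e2 : ∀ x : EuclideanSpace ℝ (Fin N),
      u x ^ 2 / (‖x‖ ^ 2 * (‖x‖ ^ 2 - ‖x‖ ^ ((N : ℝ) / 2)))
      = hardyFactor 1 k x * invSq x ^ 2 * u x ^ 2 := fun x => by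
    rw [hden2, div_eq_mul_inv, mul_inv, mul_inv, hardyFactor, invSq]
    ring
  have hp := continuousOn_hardyFactor (N := N) le_rfl hk0
  have i1 := integrableOn_weight_mul_sq hN hT
    (w := fun x => hardyFactor (9 / 10) m x * hardyFactor 1 k x)
    ((continuousOn_hardyFactor hγ hm0).mul hp)
  have i2 := integrableOn_weight_mul_sq hN hT hp
  have main := rellich_ball hN (by rw [hm_def]; ring) (by rw [hk_def]; ring)
    (by norm_num : (0 : ℝ) ≤ 9 / 10) hγ hT (m := m) (k := k)
  have split : ∀ x : EuclideanSpace ℝ (Fin N),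
      (k ^ 2 * ((m ^ 2 * hardyFactor (9 / 10) m x + ((N : ℝ) - 1)) * hardyFactor 1 k x))
        * invSq x ^ 2 * u x ^ 2
      = ((N : ℝ) - 2) ^ 2 * ((N : ℝ) - 4) ^ 2 / 16
          * ((hardyFactor (9 / 10) m x * hardyFactor 1 k x) * invSq x ^ 2 * u x ^ 2)
        + ((N : ℝ) - 1) * ((N : ℝ) - 4) ^ 2 / 4
          * (hardyFactor 1 k x * invSq x ^ 2 * u x ^ 2) := fun x => by
    generalize hardyFactor (9 / 10) m x = q
    generalize hardyFactor 1 k x = p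
    rw [hm_def, hk_def]
    ring
  simp only [split] at main
  rw [integral_add (i1.const_mul _) (i2.const_mul _), integral_const_mul, integral_const_mul]
    at main
  simp only [laplacian_eq_sum_partialDeriv hu, e1, e2]
  refine ⟨hL.sq.integrable.integrableOn, i1, i2, main, le_trans ?_ main⟩
  -- Since q ≥ 1, the first weight dominates the second, and (N - 2)² + 4(N - 1) = N² merges the two
  -- constants.
  have hle : ∫ x in Metric.ball (0 : EuclideanSpace ℝ (Fin N)) 1,
        hardyFactor 1 k x * invSq x ^ 2 * u x ^ 2
      ≤ ∫ x in Metric.ball (0 : EuclideanSpace ℝ (Fin N)) 1,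
        (hardyFactor (9 / 10) m x * hardyFactor 1 k x) * invSq x ^ 2 * u x ^ 2 := by
    refine setIntegral_mono_on i2 i1 Metric.isOpen_ball.measurableSet fun x hx => ?_
    have hx1 : ‖x‖ < 1 := mem_ball_zero_iff.1 hx
    have hq := one_le_hardyFactor (by norm_num) hγ hm0 hx1
    have hp1 := one_le_hardyFactor zero_le_one le_rfl hk0 hx1
    gcongr
    exact le_mul_of_one_le_left (by linarith) hq
  have hcoef : 0 ≤ ((N : ℝ) - 2) ^ 2 * ((N : ℝ) - 4) ^ 2 / 16 := by positivity
  linarith [mul_le_mul_of_nonneg_left hle hcoef]
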